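/- Let $X$ and $Y$ be noetherian schemes. Write $\mathrm{qcoh}(-)$ and $\mathrm{coh}(-)$ for the abelian categories of quasi-coherent and of coherent sheaves, and $\mathcal D^b(X) := \mathcal D^b(\mathrm{coh}(X))$, $\mathcal D^b(Y) := \mathcal D^b(\mathrm{coh}(Y))$. The exact inclusions $\mathrm{coh} \subset \mathrm{qcoh}$ induce functors $j_X \colon \mathcal D^b(X) \to \mathcal D^+(\mathrm{qcoh}(X))$ and $j_Y \colon \mathcal D^b(Y) \to \mathcal D^+(\mathrm{qcoh}(Y))$; "an object of $\mathcal D^+(\mathrm{qcoh}(Y))$ lies in $\mathcal D^b(Y)$" means that it is in the essential image of $j_Y$. Let $F \colon \mathrm{qcoh}(X) \to \mathrm{qcoh}(Y)$ be a left exact additive functor, and assume that there is an $F$-adapted class in $\mathrm{qcoh}(X)$, i.e. a class $\mathcal I$ of objects, containing a zero object, such that (i) $F(I^\bullet)$ is acyclic for every acyclic bounded below complex $I^\bullet$ of objects of $\mathcal I$, and (ii) every quasi-coherent sheaf on $X$ admits a monomorphism into an object of $\mathcal I$. Then the right derived functor $\mathsf RF \colon \mathcal D^+(\mathrm{qcoh}(X))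 \to \mathcal D^+(\mathrm{qcoh}(Y))$ exists (as characterised by its universal property). If moreover $\mathsf RF(\mathcal F)$ lies in $\mathcal D^b(Y)$ for every coherent sheaf $\mathcal F$ on $X$ (placed in degree $0$), then $\mathsf RF$ restricts to a functor $\mathcal D^b(X) \to \mathcal D^b(Y)$: there is a functor $G \colon \mathcal D^b(X) \to \mathcal D^b(Y)$ with $j_Y \circ G \cong \mathsf RF \circ j_X$. -/

import Mathlib

open CategoryTheory Limits AlgebraicGeometry

universe w₁ w₂ u

namespace AdaptedDerived

open Scheme.Modules

variable {X Y : Scheme.{u}}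

theorem mono_of_app_injective {M N : X.Modules} (g : M ⟶ N)
    (h : ∀ U, Function.Injective (g.app U)) : Mono g := by
  have : Mono ((toPresheaf X).map g) := by
    rw [NatTrans.mono_iff_mono_app]
    intro U
    exact ConcreteCategory.mono_of_injective _ (h U.unop)
  exact (toPresheaf X).mono_of_mono_map this

theorem app_injective {M N : X.Modules} (g : M ⟶ N) [Mono g] (U : X.Opens) :
    Function.Injective (g.app U) := by
  have h : Mono ((toPresheaf X).map g) := inferInstance
  rw [NatTrans.mono_iff_mono_app] at h
  have := h (.op U)
  exact (AddCommGrpCat.mono_iff_injective _).1 this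

theorem preservesFiniteLimits_of_mono {C D : Type*} [Category* C] [Category* D] [Abelian C] [Abelian D]
    (F : C ⥤ D) [F.Additive] [PreservesFiniteColimits F] [F.PreservesMonomorphisms] :
    PreservesFiniteLimits F := by
  refine (F.preservesFiniteLimits_tfae.out 0 3).1 fun S hS => ?_
  have hF : PreservesFiniteColimits F := inferInstance
  have h₀ : ∀ (S : ShortComplex C), S.ShortExact → (S.map F).Exact ∧ Epi (F.map S.g) :=
    (F.preservesFiniteColimits_tfae.out 3 0).1 hF
  have h₁ := h₀ S hS
  have := hS.mono_f
  exact ⟨h₁.1, inferInstance⟩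

instance restrict_preservesMonomorphisms (f : X ⟶ Y) [IsOpenImmersion f] :
    (restrictFunctor f).PreservesMonomorphisms where
  preserves g _ := mono_of_app_injective _ fun U => app_injective g (f ''ᵁ U)

instance restrict_additive (f : X ⟶ Y) [IsOpenImmersion f] :
    (restrictFunctor f).Additive where
  map_add := rfl

instance restrict_preservesFiniteLimits (f : X ⟶ Y) [IsOpenImmersion f] :
    PreservesFiniteLimits (restrictFunctor f) :=
  have : PreservesColimits (restrictFunctor f) := inferInstance
  preservesFiniteLimits_of_mono _

theorem tilde_map_app_injective {R : CommRingCat.{u}} {A B : ModuleCat.{u} R} (g : A ⟶ B) 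
   (hg : Function.Injective g.hom) (U : (Spec R).Opens) :
    Function.Injective ((tilde.map g).app U) := by
  intro s t h
  apply Subtype.ext
  funext y
  have hy : y.1.asIdeal.IsPrime := PrimeSpectrum.isPrime y.1
  exact IsLocalizedModule.map_injective y.1.asIdeal.primeCompl
    (LocalizedModule.mkLinearMap y.1.asIdeal.primeCompl A)
    (LocalizedModule.mkLinearMap y.1.asIdeal.primeCompl B) g.hom hg
    (congrFun (congrArg Subtype.val h) y)

instance (R : CommRingCat.{u}) : (tilde.functor R).PreservesMonomorphisms where
  preserves g _ := mono_of_app_injective _ fun U =>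
    tilde_map_app_injective g ((ModuleCat.mono_iff_injective g).1 inferInstance) U

instance (R : CommRingCat.{u}) : PreservesFiniteLimits (tilde.functor R) :=
  have : PreservesColimits (tilde.functor R) := inferInstance
  preservesFiniteLimits_of_mono _

/-- The quasi-coherent sheaves among all sheaves of `𝒪_X`-modules. -/
abbrev IsQcoh (X : Scheme.{u}) : ObjectProperty X.Modules := fun M => M.IsQuasicoherent

/-- An isomorphism in `X.Modules`, seen in the (same) category of sheaves of modules. -/
def toSheafIso {M N : X.Modules} (e : M ≅ N) :
    Iso (C := SheafOfModules.{u} X.ringCatSheaf) M N :=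
  ⟨e.hom, e.inv, e.hom_inv_id, e.inv_hom_id⟩

/-- Transport of a presentation along an isomorphism. -/
noncomputable def presentationOfIso {M N : X.Modules} (e : M ≅ N) (P : SheafOfModules.Presentation.{u} (R := X.ringCatSheaf) M) :
    SheafOfModules.Presentation.{u} (R := X.ringCatSheaf) N :=
  @SheafOfModules.Presentation.ofIsIso _ _ _ _ _ _ M N (toSheafIso e).hom (toSheafIso e).isIso_hom P

instance : (IsQcoh X).IsClosedUnderIsomorphisms :=
  ⟨fun e h => (SheafOfModules.isQuasicoherent.{u} X.ringCatSheaf).prop_of_iso (toSheafIso e) h⟩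

theorem IsQcoh_Spec_iff (R : CommRingCat.{u}) (M : (Spec R).Modules) :
    IsQcoh (Spec R) M ↔ (tilde.functor R).essImage M := by
  rw [← isIso_fromTildeΓ_iff]
  exact isQuasicoherent_iff_isIso_fromTildeΓ M

theorem exists_presentation_Spec (R : CommRingCat.{u}) (M : (Spec R).Modules) (h : IsQcoh _ M) :
    Nonempty (SheafOfModules.Presentation.{u} (R := (Spec R).ringCatSheaf) M) := by
  obtain ⟨A, ⟨e⟩⟩ := (IsQcoh_Spec_iff R M).1 h
  exact ⟨presentationOfIso e (presentationTilde.{u} A .univ (by simp) _ (Submodule.span_eq _))⟩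

theorem nonempty_presentation_over (M : X.Modules) {U : X.Opens} (hU : IsAffineOpen U)
    (h : IsQcoh _ ((restrictFunctor hU.fromSpec).obj M)) :
    Nonempty (SheafOfModules.over M U).Presentation := by
  obtain ⟨P⟩ := exists_presentation_Spec _ _ h
  let g : U.toScheme ⟶ Spec Γ(X, U) := hU.isoSpec.hom
  let e : restrictFunctor hU.fromSpec ⋙ restrictFunctor g ≅ restrictFunctor U.ι :=
    (restrictFunctorComp _ _).symm ≪≫ restrictFunctorCongr (by simp [g])
  let Q := presentationOfIso (e.app M) (presentationRestrict g P)
  let F : SheafOfModules.{u} U.toScheme.ringCatSheaf ⥤ SheafOfModules.{u} (X.ringCatSheaf.over U) :=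
    (U.sheafOfModulesEquivOver X.ringCatSheaf).inverse
  have : PreservesColimitsOfSize.{u, u} F :=
    (U.sheafOfModulesEquivOver X.ringCatSheaf).symm.toAdjunction.leftAdjoint_preservesColimits
  let Q' := SheafOfModules.Presentation.map Q F (U.sheafOfModulesEquivOverInverseUnit X.ringCatSheaf).symm
  let e' : SheafOfModules.over M U ≅ F.obj (M.restrict U.ι) :=
      (overEquiv U).unitIso.app (SheafOfModules.over M U) ≪≫
        (overEquiv U).inverse.mapIso ((overFunctorEquiv U).app M)
  exact ⟨Q'.ofIsIso e'.inv⟩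

theorem IsQcoh_of_affine (M : X.Modules)
    (h : ∀ (U : X.Opens) (hU : IsAffineOpen U), IsQcoh _ ((restrictFunctor hU.fromSpec).obj M)) : 
    IsQcoh X M := by
  refine SheafOfModules.QuasicoherentData.isQuasicoherent.{u} (R := X.ringCatSheaf) (M := M)
    { I := {U : X.Opens // IsAffineOpen U}
      X := fun U => U.1
      coversTop := (Opens.coversTop_iff _ _).2 (iSup_affineOpens_eq_top X)
      presentation := fun U => (nonempty_presentation_over M U.2 (h U.1 U.2)).some }

theorem IsQcoh_restrict (M : X.Modules) (h : IsQcoh X M) {U : X.Opens} (hU : IsAffineOpen U) :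
    IsQcoh _ ((restrictFunctor hU.fromSpec).obj M) :=
  @isQuasicoherent_restrictFunctor _ _ hU.fromSpec _ M h

instance IsQcoh_closedUnderLimits (J : Type) [SmallCategory J] [FinCategory J] :
    (IsQcoh X).IsClosedUnderLimitsOfShape J where
  limitsOfShape_le := by
    rintro M ⟨p⟩
    refine IsQcoh_of_affine M fun U hU => ?_
    rw [IsQcoh_Spec_iff]
    refine (tilde.functor _).essImage.prop_of_isLimit
      (isLimitOfPreserves (restrictFunctor hU.fromSpec) p.isLimit) fun j => ?_
    exact (IsQcoh_Spec_iff _ _).1 (IsQcoh_restrict _ (p.prop_diag_obj j) hU)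

instance IsQcoh_closedUnderColimits (J : Type) [SmallCategory J] [FinCategory J] :
    (IsQcoh X).IsClosedUnderColimitsOfShape J where
  colimitsOfShape_le := by
    rintro M ⟨p⟩
    refine IsQcoh_of_affine M fun U hU => ?_
    rw [IsQcoh_Spec_iff]
    refine (tilde.functor _).essImage.prop_of_isColimit
      (isColimitOfPreserves (restrictFunctor hU.fromSpec) p.isColimit) fun j => ?_
    exact (IsQcoh_Spec_iff _ _).1 (IsQcoh_restrict _ (p.prop_diag_obj j) hU)

instance : (IsQcoh X).IsClosedUnderFiniteProducts :=
  ⟨fun J _ => by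
    classical
    have := Fintype.ofFinite J
    exact IsQcoh_closedUnderLimits (Discrete J)⟩

instance : (IsQcoh X).IsClosedUnderKernels where
  kernels_le := by
    rintro _ ⟨f, k, hk, hf⟩
    refine (IsQcoh X).prop_of_isLimit hk ?_
    rintro (_ | _)
    exacts [hf.1, hf.2]

instance : (IsQcoh X).IsClosedUnderCokernels where
  cokernels_le := by
    rintro _ ⟨f, k, hk, hf⟩
    refine (IsQcoh X).prop_of_isColimit hk ?_
    rintro (_ | _)
    exacts [hf.1, hf.2]


/-- The coherent sheaves on a (locally) noetherian scheme `X`: quasi-coherent sheaves whose sections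
over every affine open `U` form a finitely generated `Γ(X, U)`-module. -/
def IsCoh (X : Scheme.{u}) : ObjectProperty X.Modules := fun M =>
  M.IsQuasicoherent ∧ ∀ U : X.Opens, IsAffineOpen U → Module.Finite Γ(X, U) Γ(M, U)

/-- The `Γ(X, U)`-linear map on sections over `U` induced by a morphism of `𝒪_X`-modules. -/
noncomputable def appLinear {M N : X.Modules} (g : M ⟶ N) (U : X.Opens) :
    Γ(M, U) →ₗ[Γ(X, U)] Γ(N, U) where
  toFun := g.app U
  map_add' := map_add _
  map_smul' r x := Scheme.Modules.Hom.app_smul g r x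

theorem app_surjective {M N : X.Modules} (hM : IsQcoh X M) (hN : IsQcoh X N) (g : M ⟶ N) [Epi g]
    {U : X.Opens} (hU : IsAffineOpen U) : Function.Surjective (g.app U) := by
  obtain ⟨A, ⟨a⟩⟩ := (IsQcoh_Spec_iff _ _).1 (IsQcoh_restrict _ hM hU)
  obtain ⟨B, ⟨b⟩⟩ := (IsQcoh_Spec_iff _ _).1 (IsQcoh_restrict _ hN hU)
  obtain ⟨t, ht⟩ := (tilde.functor _).map_surjective (a.hom ≫ (restrictFunctor hU.fromSpec).map g ≫ b.inv)
  have hg : Epi ((restrictFunctor hU.fromSpec).map g) := inferInstance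
  have ht' : Epi ((tilde.functor _).map t) := by rw [ht]; infer_instance
  have ht'' : Epi t := (tilde.functor _).epi_of_epi_map ht'
  have e : (restrictFunctor hU.fromSpec).map g = a.inv ≫ (tilde.functor _).map t ≫ b.hom := by
    rw [ht]
    simp only [Category.assoc, Iso.inv_hom_id, Category.comp_id, Iso.inv_hom_id_assoc]
  have hs : Function.Surjective (((tilde.functor _).map t).app ⊤) := by
    intro y
    obtain ⟨y', rfl⟩ := (ConcreteCategory.bijective_of_isIso (tilde.toOpen B ⊤)).2 y
    obtain ⟨x, rfl⟩ := (ModuleCat.epi_iff_surjective t).1 ht'' y'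
    refine ⟨tilde.toOpen A ⊤ x, ?_⟩
    exact congr($(tilde.toOpen_map_app t ⊤) x)
  have key : Function.Surjective (((restrictFunctor hU.fromSpec).map g).app ⊤) := by
    rw [e]
    intro y
    obtain ⟨x, hx⟩ := hs (b.inv.app ⊤ y)
    refine ⟨a.hom.app ⊤ x, ?_⟩
    have h1 : (a.inv ≫ (tilde.functor _).map t ≫ b.hom).app ⊤ (a.hom.app ⊤ x) =
      (a.hom ≫ a.inv ≫ (tilde.functor _).map t ≫ b.hom).app ⊤ x := rfl
    have h2 : b.hom.app ⊤ (((tilde.functor _).map t).app ⊤ x) = 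
      ((tilde.functor _).map t ≫ b.hom).app ⊤ x := rfl
    rw [h1, Iso.hom_inv_id_assoc, ← h2, hx]
    have h3 : b.hom.app ⊤ (b.inv.app ⊤ y) = (b.inv ≫ b.hom).app ⊤ y := rfl
    rw [h3, Iso.inv_hom_id]
    rfl
  have hU' : hU.fromSpec ''ᵁ ⊤ = U := by simp
  have key' : Function.Surjective (g.app (hU.fromSpec ''ᵁ ⊤)) := key
  rwa [hU'] at key'

theorem coh_of_injective [IsLocallyNoetherian X] {M N : X.Modules} {U : X.Opens} (hU : IsAffineOpen U) 
    (h : Module.Finite Γ(X, U) Γ(N, U)) (g : M ⟶ N) (hg : Function.Injective (g.app U)) :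
    Module.Finite Γ(X, U) Γ(M, U) := by
  have : IsNoetherianRing Γ(X, U) := IsLocallyNoetherian.component_noetherian ⟨U, hU⟩
  exact Module.Finite.of_injective (appLinear g U) hg

theorem coh_of_surjective [IsLocallyNoetherian X] {M N : X.Modules} {U : X.Opens}
    (h : Module.Finite Γ(X, U) Γ(M, U)) (g : M ⟶ N) (hg : Function.Surjective (g.app U)) :
    Module.Finite Γ(X, U) Γ(N, U) := 
  Module.Finite.of_surjective (appLinear g U) hg

instance [IsLocallyNoetherian X] : (IsCoh X).IsClosedUnderKernels where
  kernels_le := by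
    rintro _ ⟨f, k, hk, hf⟩
    refine ⟨(IsQcoh X).prop_of_isLimit_kernelFork hk hf.1.1 hf.2.1, fun U hU => ?_⟩
    have : Mono k.ι := Fork.IsLimit.mono hk
    exact coh_of_injective hU (hf.1.2 U hU) k.ι (app_injective k.ι U)

instance [IsLocallyNoetherian X] : (IsCoh X).IsClosedUnderCokernels where
  cokernels_le := by
    rintro _ ⟨f, k, hk, hf⟩
    have hq := (IsQcoh X).prop_of_isColimit_cokernelCofork hk hf.1.1 hf.2.1
    refine ⟨hq, fun U hU => ?_⟩
    have : Epi k.π := Cofork.IsColimit.epi hk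
    exact coh_of_surjective (hf.2.2 U hU) k.π (app_surjective hf.2.1 hq k.π hU)

instance : (IsCoh X).ContainsZero where
  exists_zero := by
    obtain ⟨Z, hZ, hZq⟩ := (IsQcoh X).exists_prop_of_containsZero
    refine ⟨Z, hZ, hZq, fun U hU => ?_⟩
    have hx : ∀ x : Γ(Z, U), x = 0 := fun x =>
      congr(($(hZ.eq_of_src (𝟙 Z) 0)).app U x)
    have : Subsingleton Γ(Z, U) := ⟨fun x y => by rw [hx x, hx y]⟩
    infer_instance

instance : (IsCoh X).IsClosedUnderIsomorphisms where
  of_iso e h := ⟨(IsQcoh X).prop_of_iso e h.1, fun U hU => by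
    have := h.2 U hU
    refine Module.Finite.of_surjective (appLinear e.hom U) ?_
    exact (ConcreteCategory.bijective_of_isIso (e.hom.app U)).2⟩

theorem IsCoh_biprod {M N : X.Modules} (hM : IsCoh X M) (hN : IsCoh X N) : IsCoh X (M ⊞ N) := by
  refine ⟨(IsQcoh X).prop_of_isLimit (BinaryBiproduct.isLimit M N) ?_, fun U hU => ?_⟩
  · rintro ⟨_ | _⟩
    exacts [hM.1, hN.1]
  have := hM.2 U hU
  have := hN.2 U hU
  refine Module.Finite.of_surjective
    ((appLinear (biprod.inl : M ⟶ M ⊞ N) U).coprod (appLinear (biprod.inr : N ⟶ M ⊞ N) U)) ?_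
  intro x
  refine ⟨((biprod.fst : M ⊞ N ⟶ M).app U x, (biprod.snd : M ⊞ N ⟶ N).app U x), ?_⟩
  have h : (biprod.fst ≫ biprod.inl + biprod.snd ≫ biprod.inr : M ⊞ N ⟶ M ⊞ N) = 𝟙 _ :=
    biprod.total
  exact congr(($h).app U x)

instance : (IsCoh X).IsClosedUnderBinaryProducts where
  limitsOfShape_le := by
    rintro M ⟨p⟩
    refine (IsCoh X).prop_of_iso (IsLimit.conePointUniqueUpToIso
      ((IsLimit.postcomposeInvEquiv (diagramIsoPair p.diag) _).2
        (BinaryBiproduct.isLimit (p.diag.obj ⟨.left⟩) (p.diag.obj ⟨.right⟩))) p.isLimit) ?_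
    exact IsCoh_biprod (p.prop_diag_obj _) (p.prop_diag_obj _)

instance : (IsCoh X).IsClosedUnderFiniteProducts :=
  ObjectProperty.IsClosedUnderFiniteProducts.mk'

/-- The category `qcoh(X)` of quasi-coherent sheaves on `X`. -/
abbrev Qcoh (X : Scheme.{u}) : Type (u + 1) := (IsQcoh X).FullSubcategory
/-- The category `coh(X)` of coherent sheaves on the (locally noetherian) scheme `X`. -/
abbrev Coh (X : Scheme.{u}) : Type (u + 1) := (IsCoh X).FullSubcategory


/-- The (exact) inclusion `coh(X) ⥤ qcoh(X)`. -/
abbrev cohToQcoh (X : Scheme.{u}) : Coh X ⥤ Qcoh X :=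
  ObjectProperty.ιOfLE fun _ h => h.1

theorem ι_preservesFiniteLimits {C : Type*} [Category* C] [Abelian C] (P : ObjectProperty C)
    [P.ContainsZero] [P.IsClosedUnderKernels] [P.IsClosedUnderCokernels]
    [P.IsClosedUnderFiniteProducts] : PreservesFiniteLimits P.ι :=
  (P.ι.preservesFiniteLimits_tfae.out 2 3).1 P.preservesKernels_ι

theorem ι_preservesFiniteColimits {C : Type*} [Category* C] [Abelian C] (P : ObjectProperty C)
    [P.ContainsZero] [P.IsClosedUnderKernels] [P.IsClosedUnderCokernels]
    [P.IsClosedUnderFiniteProducts] : PreservesFiniteColimits P.ι :=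
  (P.ι.preservesFiniteColimits_tfae.out 2 3).1 P.preservesCokernels_ι

instance [IsLocallyNoetherian X] : PreservesFiniteLimits (cohToQcoh X) :=
  have : PreservesFiniteLimits (cohToQcoh X ⋙ (IsQcoh X).ι) :=
    ι_preservesFiniteLimits (IsCoh X)
  preservesFiniteLimits_of_reflects_of_preserves _ (IsQcoh X).ι

instance [IsLocallyNoetherian X] : PreservesFiniteColimits (cohToQcoh X) :=
  have : PreservesFiniteColimits (cohToQcoh X ⋙ (IsQcoh X).ι) :=
    ι_preservesFiniteColimits (IsCoh X)
  preservesFiniteColimits_of_reflects_of_preserves _ (IsQcoh X).ι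

instance : (cohToQcoh X).Additive where
  map_add := rfl

/-- The inclusion functor `D^b(coh(X)) ⥤ D^+(qcoh(X))`, induced by the exact inclusion
`coh(X) ⥤ qcoh(X)`. -/
noncomputable def dbCohInclusion (X : Scheme.{u}) [IsLocallyNoetherian X]
    [HasDerivedCategory.{w₁} (Coh X)] [HasDerivedCategory.{w₂} (Qcoh X)] :
    DerivedCategory.Bounded (Coh X) ⥤ DerivedCategory.Plus (Qcoh X) :=
  DerivedCategory.TStructure.t.plus.lift
    (DerivedCategory.Bounded.ι ⋙ (cohToQcoh X).mapDerivedCategory) fun K => by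
      obtain ⟨⟨n, L, e, h⟩, -⟩ := K.property
      refine ⟨n, _, (cohToQcoh X).mapDerivedCategory.mapIso e ≪≫
        (cohToQcoh X).mapDerivedCategoryFactors.app L, ?_⟩
      have : (cohToQcoh X).Faithful := inferInstance
      exact (CochainComplex.isStrictlyGE_mapHomologicalComplex_obj_iff L (cohToQcoh X) n).2 h

/-- A class `I` of objects of an abelian category `A` is adapted to the functor `F : A ⥤ B` if `F`
sends acyclic bounded below complexes of objects of `I` to acyclic complexes, and every object of
`A` embeds into an object of `I`. The class contains a zero object, as otherwise there would be no
bounded below complexes of objects of `I`. -/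
structure IsAdaptedClass {A B : Type*} [Category* A] [Category* B] [Abelian A] [Abelian B]
    (F : A ⥤ B) [F.Additive] (I : ObjectProperty A) : Prop where
  containsZero : I.ContainsZero
  map_acyclic : ∀ K : CochainComplex A ℤ, (∃ n : ℤ, K.IsStrictlyGE n) → (∀ i : ℤ, I (K.X i)) →
    K.Acyclic → ((F.mapHomologicalComplex (ComplexShape.up ℤ)).obj K).Acyclic
  exists_mono : ∀ M : A, ∃ (J : A) (f : M ⟶ J), I J ∧ Mono f

end AdaptedDerived

/-! Existence of the derived functor. An adapted class need not be closed under sums or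
isomorphisms, so complexes in it need not form a triangulated subcategory. It is enlarged to
`acyclicClass F I`: the objects all of whose iterated cosyzygies, formed with any embeddings into
objects of `I`, start short exact sequences that `F` preserves. Adaptedness puts `I` inside this
class, and `acyclicUpTo_closure` makes it closed under extensions and under cokernels of
monomorphisms. Cutting an acyclic bounded below complex into its cycles then shows that `F` keeps it
acyclic if its terms lie in the class (`map_acyclic_of_acyclicClass`). Every bounded below complex
has a quasi-isomorphism to one with terms in `I` (`exists_quasiIso_of_enough`). Hence these
complexes form a right derivability structure, and `RF` exists and is computed on them by applying
`F` termwise.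

Restriction. Coherent sheaves in degree `0` generate `D^b(coh X)` under shifts and cones, and on
objects `RF` respects shifts and distinguished triangles. It remains to see that the essential image
of `j_Y` is closed under cones, which holds because `j_Y` is full. As `j_Y` is also faithful, it can
be inverted on its essential image, which gives `G`.

Full faithfulness. By dévissage one compares Ext groups of coherent sheaves in `coh` and in `qcoh`,
by induction on the degree. A class of positive degree on `M` is killed by some epimorphism `b ⟶ M`
of quasi-coherent sheaves, and `exists_coh_epi` makes `b` coherent. This rests on
`exists_coh_section`: every section `s` of a quasi-coherent `G` comes from a coherent sheaf. On each
member `U` of a finite affine cover a finitely generated submodule `A U` of the sections of `G` over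
`U` is chosen that generates `s` locally. The coherent sheaf is the common kernel of the maps from
`G` to the push-forwards of the quotients of `G|U` by `A U`; its sections over `U` embed into `A U`.
-/

namespace AdaptedDerived
open Scheme.Modules
-- Quasi-coherence in terms of sections over basic opens.
variable {X Y : Scheme.{u}}

/-- Restriction of sections of a sheaf of modules. -/
noncomputable def res (M : X.Modules) {U V : X.Opens} (h : V ≤ U) : Γ(M, U) →+ Γ(M, V) :=
  (M.presheaf.map (homOfLE h).op).hom

theorem res_res (M : X.Modules) {U V W : X.Opens} (h : V ≤ U) (h' : W ≤ V) (s : Γ(M, U)) :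
    res M h' (res M h s) = res M (h'.trans h) s := by
  simp only [res, ← AddCommGrpCat.comp_apply, ← Functor.map_comp]
  rfl

theorem res_self (M : X.Modules) {U : X.Opens} (h : U ≤ U) (s : Γ(M, U)) :
    res M h s = s := by
  simp [res]

theorem res_smul (M : X.Modules) {U V : X.Opens} (h : V ≤ U) (r : Γ(X, U)) (s : Γ(M, U)) :
    res M h (r • s) = X.presheaf.map (homOfLE h).op r • res M h s :=
  map_smul M (homOfLE h) r s

theorem app_res {M N : X.Modules} (g : M ⟶ N) {U V : X.Opens} (h : V ≤ U) (s : Γ(M, U)) :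
    g.app V (res M h s) = res N h (g.app U s) :=
  congr($(g.mapPresheaf.naturality (homOfLE h).op) s)

/-- On `Spec Γ(X, U)` the ring acts through `ΓSpecIso`, on `X` through restriction of functions.
Their agreement lets localization statements pass from the spectrum to `X`. -/
theorem smul_restrict_fromSpec {U : X.Opens} (hU : IsAffineOpen U) (M : X.Modules)
    (W : (Spec Γ(X, U)).Opens) (h : hU.fromSpec ''ᵁ W ≤ U) (r : Γ(X, U))
    (x : Γ(M.restrict hU.fromSpec, W)) :
    (M.restrictAppIso hU.fromSpec W).hom (r • x) =
      X.presheaf.map (homOfLE h).op r • (M.restrictAppIso hU.fromSpec W).hom x := by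
  rw [smul_Spec_def, smul_restrictAppIso_hom_apply]
  congr 1
  apply (ConcreteCategory.bijective_of_isIso (hU.fromSpec.appIso W).hom).1
  have h₁ : X.presheaf.map (homOfLE h).op ≫ (hU.fromSpec.appIso W).hom =
      (Scheme.ΓSpecIso Γ(X, U)).inv ≫ (Spec Γ(X, U)).presheaf.map W.leTop.op := by
    rw [Scheme.Hom.appIso_hom', Scheme.Hom.map_appLE, Scheme.Hom.appLE, hU.fromSpec_app_self]
    simp only [Category.assoc, ← Functor.map_comp]
    rfl
  rw [← CommRingCat.comp_apply, ← CommRingCat.comp_apply, ← CommRingCat.comp_apply,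
    ← CommRingCat.comp_apply, h₁,
    Iso.inv_hom_id, Category.comp_id]

theorem fromSpec_image_top {U : X.Opens} (hU : IsAffineOpen U) : hU.fromSpec ''ᵁ ⊤ = U := by
  simp

theorem isLocalizing_restrict_fromSpec (M : X.Modules) (hM : IsQcoh X M) {U : X.Opens}
    (hU : IsAffineOpen U) :
    IsLocalizing (modulesSpecToSheaf.obj (M.restrict hU.fromSpec)) := by
  rw [← isIso_fromTildeΓ_iff_isLocalizing, isIso_fromTildeΓ_iff, ← IsQcoh_Spec_iff]
  exact IsQcoh_restrict M hM hU

theorem exists_pow_smul_eq_zero (M : X.Modules) (hM : IsQcoh X M) {U : X.Opens}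
    (hU : IsAffineOpen U) (f : Γ(X, U)) (s : Γ(M, U))
    (hs : res M (X.basicOpen_le f) s = 0) : ∃ n : ℕ, f ^ n • s = 0 := by
  have key := isLocalizing_restrict_fromSpec M hM hU f
  have e₁ := fromSpec_image_top hU
  let D : (Spec Γ(X, U)).Opens := PrimeSpectrum.basicOpen f
  have e₂ : hU.fromSpec ''ᵁ D = X.basicOpen f := hU.fromSpec_image_basicOpen f
  let s' : Γ(M.restrict hU.fromSpec, ⊤) := (M.restrictAppIso hU.fromSpec ⊤).inv (res M e₁.le s)
  have h0 : (M.restrict hU.fromSpec).presheaf.map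
      (homOfLE (le_top : D ≤ ⊤)).op s' = 0 := by
    have : res M (e₂.le.trans (X.basicOpen_le f)) s = 0 := by
      rw [← res_res M (X.basicOpen_le f) e₂.le, hs, map_zero]
    refine Eq.trans ?_ this
    exact res_res M e₁.le _ s
  obtain ⟨⟨_, n, rfl⟩, hn⟩ := (key.eq_zero_iff (.powers f) (m := s')).mp h0
  refine ⟨n, ?_⟩
  have hn' : f ^ n • s' = 0 := hn
  have h1 := congr((M.restrictAppIso hU.fromSpec ⊤).hom $hn')
  rw [smul_restrict_fromSpec hU M ⊤ e₁.le] at h1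
  have h2 : res M e₁.le (f ^ n • s) = 0 := by
    rw [res_smul]
    exact h1.trans (map_zero _)
  have h3 := congr(res M e₁.ge $h2)
  rwa [res_res, res_self, map_zero] at h3

theorem exists_res_eq_pow_smul (M : X.Modules) (hM : IsQcoh X M) {U : X.Opens}
    (hU : IsAffineOpen U) (f : Γ(X, U)) (t : Γ(M, X.basicOpen f)) :
    ∃ (n : ℕ) (s : Γ(M, U)), res M (X.basicOpen_le f) s =
      X.presheaf.map (homOfLE (X.basicOpen_le f)).op (f ^ n) • t := by
  have key := isLocalizing_restrict_fromSpec M hM hU f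
  have e₁ := fromSpec_image_top hU
  let D : (Spec Γ(X, U)).Opens := PrimeSpectrum.basicOpen f
  have e₂ : hU.fromSpec ''ᵁ D = X.basicOpen f := hU.fromSpec_image_basicOpen f
  let t' : Γ(M.restrict hU.fromSpec, D) :=
    (M.restrictAppIso hU.fromSpec _).inv (res M e₂.le t)
  obtain ⟨⟨s', ⟨_, n, rfl⟩⟩, hn⟩ := key.surj t'
  let s := (M.restrictAppIso hU.fromSpec ⊤).hom s'
  refine ⟨n, res M e₁.ge s, ?_⟩
  have hn' : f ^ n • t' = (M.restrict hU.fromSpec).presheaf.map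
      (homOfLE (le_top : D ≤ ⊤)).op s' := hn
  have h1 := congr((M.restrictAppIso hU.fromSpec _).hom $hn')
  rw [smul_restrict_fromSpec hU M _ (e₂.le.trans (X.basicOpen_le f))] at h1
  have h2 : X.presheaf.map (homOfLE (e₂.le.trans (X.basicOpen_le f))).op (f ^ n) • res M e₂.le t =
    res M (e₂.le.trans ((X.basicOpen_le f).trans e₁.ge)) s := h1
  have h3 := congr(res M e₂.ge $h2)
  rw [res_smul, res_res, res_res, res_self] at h3
  rw [res_res, ← h3, ← CommRingCat.comp_apply, ← Functor.map_comp]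
  rfl

/-- The pullback to `Spec Γ(X, U)` comes from a module once its sections over `D(f)` are the
localization at `f` of the global ones. That `f` acts invertibly over `D(f)` is automatic, so the
two halves `h₁` and `h₂` suffice. -/
theorem IsQcoh_of_localizing (M : X.Modules)
    (h₁ : ∀ (U : X.Opens) (_ : IsAffineOpen U) (f : Γ(X, U)) (s : Γ(M, U)),
      res M (X.basicOpen_le f) s = 0 → ∃ n : ℕ, f ^ n • s = 0)
    (h₂ : ∀ (U : X.Opens) (_ : IsAffineOpen U) (f : Γ(X, U)) (t : Γ(M, X.basicOpen f)),
      ∃ (n : ℕ) (s : Γ(M, U)), res M (X.basicOpen_le f) s =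
        X.presheaf.map (homOfLE (X.basicOpen_le f)).op (f ^ n) • t) :
    IsQcoh X M := by
  refine IsQcoh_of_affine M fun U hU => ?_
  rw [IsQcoh_Spec_iff, ← isIso_fromTildeΓ_iff]
  refine (isIso_fromTildeΓ_iff_isLocalizing _).2 fun f => ?_
  have e₁ := fromSpec_image_top hU
  let D : (Spec Γ(X, U)).Opens := PrimeSpectrum.basicOpen f
  have e₂ : hU.fromSpec ''ᵁ D = X.basicOpen f := hU.fromSpec_image_basicOpen f
  refine IsLocalizedModule.Away.mk_of_addCommGroup ?_ ?_ ?_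
  · exact isUnit_algebraMap_end_of_le_basicOpen f le_rfl
  · intro (t' : Γ(M.restrict hU.fromSpec, D))
    let t := res M e₂.ge ((M.restrictAppIso hU.fromSpec _).hom t')
    obtain ⟨n, s, hs⟩ := h₂ U hU f t
    let s' : Γ(M.restrict hU.fromSpec, ⊤) := (M.restrictAppIso hU.fromSpec ⊤).inv (res M e₁.le s)
    refine ⟨n, s', ?_⟩
    change f ^ n • t' = (M.restrict hU.fromSpec).presheaf.map
      (homOfLE (le_top : D ≤ ⊤)).op s'
    apply (ConcreteCategory.bijective_of_isIso (M.restrictAppIso hU.fromSpec _).hom).1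
    rw [smul_restrict_fromSpec hU M _ (e₂.le.trans (X.basicOpen_le f))]
    have h3 := congr(res M e₂.le $hs)
    rw [res_smul, res_res, res_res, res_self, ← CommRingCat.comp_apply, ← Functor.map_comp] at h3
    refine h3.symm.trans ?_
    exact (res_res M e₁.le _ s).symm
  · intro (s' : Γ(M.restrict hU.fromSpec, ⊤)) hs'
    let s := res M e₁.ge ((M.restrictAppIso hU.fromSpec _).hom s')
    have h0 : res M (X.basicOpen_le f) s = 0 := by
      have : res M (e₂.le.trans ((X.basicOpen_le f).trans e₁.ge))
        ((M.restrictAppIso hU.fromSpec _).hom s') = 0 := hs'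
      have := congr(res M e₂.ge $this)
      rw [res_res, map_zero] at this
      rw [res_res]
      exact this
    obtain ⟨n, hn⟩ := h₁ U hU f s h0
    refine ⟨n, ?_⟩
    change f ^ n • s' = 0
    apply (ConcreteCategory.bijective_of_isIso (M.restrictAppIso hU.fromSpec _).hom).1
    rw [smul_restrict_fromSpec hU M _ e₁.le]
    have h3 := congr(res M e₁.le $hn)
    rw [res_smul, res_res, res_self, map_zero] at h3
    exact h3.trans (map_zero _).symm
end AdaptedDerived

/-! ### Kernels and quotients of quasi-coherent sheaves, cut out by sections. -/

namespace AdaptedDerived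
open Scheme.Modules
variable {X Y : Scheme.{u}}

theorem eq_zero_of_res_eq_zero (M : X.Modules) {ι : Type*} {U : X.Opens} (V : ι → X.Opens)
    (hV : ∀ i, V i ≤ U) (hU : U ≤ ⨆ i, V i) (s : Γ(M, U)) (h : ∀ i, res M (hV i) s = 0) :
    s = 0 :=
  TopCat.Sheaf.eq_of_locally_eq' ⟨_, M.isSheaf⟩ V U (fun i => homOfLE (hV i)) hU s 0 fun i =>
    (h i).trans (map_zero (res M (hV i))).symm

theorem isUnit_res_basicOpen {U V : X.Opens} (f : Γ(X, U)) (h : V ≤ X.basicOpen f) :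
    IsUnit (X.presheaf.map (homOfLE (h.trans (X.basicOpen_le f))).op f) := by
  have h₁ := (RingedSpace.isUnit_res_basicOpen X.toRingedSpace f).map
    (X.presheaf.map (homOfLE h).op).hom
  have h₂ : X.presheaf.map (homOfLE (h.trans (X.basicOpen_le f))).op =
    X.presheaf.map (homOfLE (X.basicOpen_le f)).op ≫ X.presheaf.map (homOfLE h).op := by
    rw [← Functor.map_comp]
    rfl
  rw [h₂]
  exact h₁

theorem exists_pow_smul_eq_zero_of_isCompact (M : X.Modules) (hM : IsQcoh X M) {U : X.Opens}
    (hU : IsCompact (U : Set X)) (f : Γ(X, U)) (s : Γ(M, U))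
    (hs : res M (X.basicOpen_le f) s = 0) : ∃ n : ℕ, f ^ n • s = 0 := by
  obtain ⟨S, hS, e⟩ := isCompact_iff_finite_and_eq_biUnion_affineOpens.mp hU
  have := hS.to_subtype
  cases nonempty_fintype S
  have hle (V : S) : V.1.1 ≤ U := by
    rw [e]
    exact le_iSup₂_of_le V.1 V.2 le_rfl
  have key (V : S) : ∃ n : ℕ, X.presheaf.map (homOfLE (hle V)).op f ^ n • res M (hle V) s = 0 := by
    refine exists_pow_smul_eq_zero M hM V.1.2 _ _ ?_
    have h₁ : X.basicOpen (X.presheaf.map (homOfLE (hle V)).op f) ≤ X.basicOpen f := by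
      rw [Scheme.basicOpen_res]
      exact inf_le_right
    rw [res_res, ← res_res M (X.basicOpen_le f) h₁, hs, map_zero]
  choose n hn using key
  -- The cover is finite, so the largest exponent works on every member.
  refine ⟨Finset.univ.sup n, eq_zero_of_res_eq_zero M (fun V : S => V.1.1) hle ?_ _ fun V => ?_⟩
  · rw [e, ← iSup_subtype'']
  · have : Finset.univ.sup n = (Finset.univ.sup n - n V) + n V :=
      (Nat.sub_add_cancel (Finset.le_sup (Finset.mem_univ V))).symm
    rw [res_smul, map_pow, this, pow_add, mul_smul, hn, smul_zero]

/-- A section of `M` over an affine open is annihilated by a power of `f` as soon as it vanishes on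
the locus where `f` is invertible. -/
def IsPowTorsion (M : X.Modules) : Prop :=
  ∀ (U : X.Opens) (_ : IsAffineOpen U) (f : Γ(X, U)) (s : Γ(M, U)),
    res M (X.basicOpen_le f) s = 0 → ∃ n : ℕ, f ^ n • s = 0

/-- Preimages of affine opens are compact, though perhaps not affine, and compactness is enough for
the torsion half of localization. -/
theorem isPowTorsion_pushforward [IsNoetherian X] (f : Y ⟶ X) [IsOpenImmersion f]
    (M : Y.Modules) (hM : IsQcoh Y M) : IsPowTorsion ((pushforward f).obj M) := by
  intro U hU r s hs
  have hc : IsCompact ((f ⁻¹ᵁ U : Y.Opens) : Set Y) := by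
    have : TopologicalSpace.NoetherianSpace Y := f.isOpenEmbedding.isInducing.noetherianSpace
    exact TopologicalSpace.NoetherianSpace.isCompact _
  have e : Y.basicOpen (f.app U r) = f ⁻¹ᵁ X.basicOpen r := (Scheme.preimage_basicOpen f r).symm
  have hs' : res M (Y.basicOpen_le (f.app U r)) s = 0 := by
    have h₁ : res M (f.preimage_mono (X.basicOpen_le r)) s = 0 := hs
    exact (res_res M (f.preimage_mono (X.basicOpen_le r)) e.le s).symm.trans
      ((congrArg (res M e.le) h₁).trans (map_zero _))
  obtain ⟨n, hn⟩ := exists_pow_smul_eq_zero_of_isCompact M hM hc (f.app U r) s hs'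
  refine ⟨n, ?_⟩
  rw [← map_pow] at hn
  exact hn

theorem biprod_ext_section {M N : X.Modules} {U : X.Opens} (x : Γ(M ⊞ N, U))
    (h₁ : (biprod.fst : M ⊞ N ⟶ M).app U x = 0) (h₂ : (biprod.snd : M ⊞ N ⟶ N).app U x = 0) :
    x = 0 := by
  have h : (biprod.fst ≫ biprod.inl + biprod.snd ≫ biprod.inr : M ⊞ N ⟶ M ⊞ N) = 𝟙 _ :=
    biprod.total
  have h₃ : (biprod.inl : M ⟶ M ⊞ N).app U ((biprod.fst : M ⊞ N ⟶ M).app U x) +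
      (biprod.inr : N ⟶ M ⊞ N).app U ((biprod.snd : M ⊞ N ⟶ N).app U x) = x :=
    congr(($h).app U x)
  rw [← h₃, h₁, h₂, map_zero, map_zero, add_zero]

theorem isPowTorsion_biprod (M N : X.Modules) (hM : IsPowTorsion M) (hN : IsPowTorsion N) :
    IsPowTorsion (M ⊞ N) := by
  intro U hU f s hs
  obtain ⟨m, hm⟩ := hM U hU f ((biprod.fst : M ⊞ N ⟶ M).app U s) (by
    rw [← app_res, hs, map_zero])
  obtain ⟨n, hn⟩ := hN U hU f ((biprod.snd : M ⊞ N ⟶ N).app U s) (by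
    rw [← app_res, hs, map_zero])
  refine ⟨m + n, biprod_ext_section _ ?_ ?_⟩
  · rw [Hom.app_smul, add_comm, pow_add, mul_smul, hm, smul_zero]
  · rw [Hom.app_smul, pow_add, mul_smul, hn, smul_zero]

/-- The forgetful functor to presheaves preserves kernels, and evaluation of presheaves at `U` is
exact. -/
theorem exists_kernel_section {M N : X.Modules} (g : M ⟶ N) (U : X.Opens) (s : Γ(M, U))
    (hs : g.app U s = 0) : ∃ t : Γ(kernel g, U), (kernel.ι g).app U t = s := by
  let S := ShortComplex.mk _ _ (kernel.condition g)
  have : (toPresheaf X).Additive := { map_add := rfl }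
  have : PreservesLimit (parallelPair S.g 0) (toPresheaf X) := inferInstance
  have h₁ : (S.map (toPresheaf X)).Exact :=
    (ShortComplex.exact_kernel g).map_of_mono_of_preservesKernel (toPresheaf X) inferInstance this
  let E : TopCat.Presheaf Ab.{u} X ⥤ Ab.{u} := (evaluation X.Opensᵒᵖ Ab.{u}).obj (.op U)
  have : E.Additive := { map_add := rfl }
  have : PreservesFiniteLimits E :=
    inferInstanceAs (PreservesFiniteLimits ((evaluation X.Opensᵒᵖ Ab.{u}).obj (.op U)))
  have : PreservesFiniteColimits E :=
    inferInstanceAs (PreservesFiniteColimits ((evaluation X.Opensᵒᵖ Ab.{u}).obj (.op U)))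
  have h₂ := ShortComplex.Exact.map h₁ E
  rw [ShortComplex.ab_exact_iff] at h₂
  exact h₂ s hs

/-- If `f ^ n • t` extends to a section `s` of `M`, then `g s` vanishes where `f` is invertible, so
`f ^ m • s` lies in the kernel for some `m`. Only the torsion half of localization is asked of `N`.
-/
theorem IsQcoh_kernel {M N : X.Modules} (g : M ⟶ N) (hM : IsQcoh X M) (hN : IsPowTorsion N) :
    IsQcoh X (kernel g) := by
  have inj (U : X.Opens) := app_injective (kernel.ι g) U
  have hg (U : X.Opens) (t : Γ(kernel g, U)) : g.app U ((kernel.ι g).app U t) = 0 :=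
    congr(($(kernel.condition g)).app U t)
  refine IsQcoh_of_localizing _ (fun U hU f s hs => ?_) (fun U hU f t => ?_)
  · obtain ⟨n, hn⟩ := exists_pow_smul_eq_zero M hM hU f ((kernel.ι g).app U s)
      (by rw [← app_res, hs, map_zero])
    exact ⟨n, inj U (by rw [Hom.app_smul, hn, map_zero])⟩
  · obtain ⟨n, s, hs⟩ := exists_res_eq_pow_smul M hM hU f ((kernel.ι g).app _ t)
    obtain ⟨m, hm⟩ := hN U hU f (g.app U s) (by
      rw [← app_res, hs, Hom.app_smul, hg, smul_zero])
    obtain ⟨s', hs'⟩ := exists_kernel_section g U (f ^ m • s) (by rw [Hom.app_smul, hm])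
    refine ⟨m + n, s', inj _ ?_⟩
    rw [app_res, hs', res_smul, hs, Hom.app_smul, smul_smul, ← map_mul, pow_add]

theorem section_of_isZero {M : X.Modules} (hM : IsZero M) {U : X.Opens} (s : Γ(M, U)) : s = 0 :=
  congr(($(hM.eq_of_src (𝟙 M) 0)).app U s)

/-- Turns a finite intersection of kernels into a single kernel, to which `IsQcoh_kernel` applies.
-/
theorem exists_finset_inf {G : X.Modules} {ι : Type*} (Q : ι → X.Modules) (φ : ∀ i, G ⟶ Q i)
    (hQ : ∀ i, IsPowTorsion (Q i)) (S : Finset ι) :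
    ∃ (P : X.Modules) (ψ : G ⟶ P), IsPowTorsion P ∧
      ∀ (U : X.Opens) (s : Γ(G, U)), ψ.app U s = 0 ↔ ∀ i ∈ S, (φ i).app U s = 0 := by
  classical
  induction S using Finset.induction_on with
  | empty =>
    obtain ⟨Z, hZ⟩ : ∃ Z : X.Modules, IsZero Z := HasZeroObject.zero
    refine ⟨Z, 0, ?_, fun U s => ?_⟩
    · intro U _ f s _
      exact ⟨0, section_of_isZero hZ _⟩
    · simp only [Finset.notMem_empty, false_implies, implies_true, iff_true]
      rfl
  | insert i S hi ih =>
    obtain ⟨P, ψ, hP, h⟩ := ih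
    refine ⟨Q i ⊞ P, biprod.lift (φ i) ψ, isPowTorsion_biprod _ _ (hQ i) hP, fun U s => ?_⟩
    have h₁ : (biprod.fst : Q i ⊞ P ⟶ _).app U ((biprod.lift (φ i) ψ).app U s) = (φ i).app U s :=
      congr(($(biprod.lift_fst (φ i) ψ)).app U s)
    have h₂ : (biprod.snd : Q i ⊞ P ⟶ _).app U ((biprod.lift (φ i) ψ).app U s) = ψ.app U s :=
      congr(($(biprod.lift_snd (φ i) ψ)).app U s)
    rw [Finset.forall_mem_insert, ← h, ← h₁, ← h₂]
    exact ⟨fun h => by simp [h], fun h => biprod_ext_section _ h.1 h.2⟩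

/-- A linear map as a morphism of `ModuleCat`. -/
abbrev moduleCatHom {R : Type u} [CommRing R] (L : ModuleCat.{u} R) {Q : Type u} [AddCommGroup Q]
    [Module R Q] (π : L →ₗ[R] Q) : L ⟶ ModuleCat.of R Q :=
  ModuleCat.ofHom π

theorem exists_hom_of_linearMap (R : CommRingCat.{u}) (N : (Spec R).Modules) [IsIso N.fromTildeΓ]
    {Q : Type u} [AddCommGroup Q] [Module R Q] (π : Γ(N, ⊤) →ₗ[R] Q) :
    ∃ (T : (Spec R).Modules) (_ : IsQcoh _ T) (c : N ⟶ T),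
      ∀ x : Γ(N, ⊤), c.app ⊤ x = 0 ↔ π x = 0 := by
  let L : ModuleCat R := (modulesSpecToSheaf.obj N).presheaf.obj (.op ⊤)
  let p : L ⟶ ModuleCat.of R Q := moduleCatHom L π
  have hT : (tilde (ModuleCat.of R Q)).IsQuasicoherent := inferInstance
  refine ⟨tilde (ModuleCat.of R Q), hT, inv N.fromTildeΓ ≫ tilde.map p, fun x => ?_⟩
  let y : Γ(tilde L, ⊤) := tilde.toOpen L ⊤ x
  have h₁ : N.fromTildeΓ.app ⊤ y = x :=
    congr($(toOpen_fromTildeΓ_app N ⊤) x).trans (res_self N le_rfl x)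
  have h₂ : (inv N.fromTildeΓ).app ⊤ x = y := by
    rw [← h₁]
    exact congr(($(IsIso.hom_inv_id N.fromTildeΓ)).app ⊤ y)
  have h₃ : (inv N.fromTildeΓ ≫ tilde.map p).app ⊤ x =
      tilde.toOpen (ModuleCat.of R Q) ⊤ (π x) := by
    change (tilde.map p).app ⊤ ((inv N.fromTildeΓ).app ⊤ x) = _
    rw [h₂]
    exact congr($(tilde.toOpen_map_app p ⊤) x)
  rw [h₃]
  exact map_eq_zero_iff (tilde.toOpen (ModuleCat.of R Q) ⊤).hom
    (ConcreteCategory.bijective_of_isIso (tilde.toOpen (ModuleCat.of R Q) ⊤)).1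

/-- The quotient map of `G` obtained by dividing out a submodule of the sections over an affine
open. -/
theorem exists_quotient [IsNoetherian X] (G : X.Modules) (hG : IsQcoh X G) {V : X.Opens}
    (hV : IsAffineOpen V) (A : Submodule Γ(X, V) Γ(G, V)) :
    ∃ (Q : X.Modules) (φ : G ⟶ Q), IsPowTorsion Q ∧ (∀ s : Γ(G, V), φ.app V s = 0 ↔ s ∈ A) ∧
      ∀ (W : X.Opens) (s : Γ(G, W)), φ.app (V ⊓ W) (res G inf_le_right s) = 0 → φ.app W s = 0 := by
  let N := G.restrict hV.fromSpec
  have hN : IsIso N.fromTildeΓ :=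
    isIso_fromTildeΓ_iff.2 ((IsQcoh_Spec_iff _ _).1 (IsQcoh_restrict G hG hV))
  have e₁ := fromSpec_image_top hV
  let ρ : Γ(N, ⊤) →+ Γ(G, V) := (res G e₁.ge).comp (G.restrictAppIso hV.fromSpec ⊤).hom.hom
  have hρ (r : Γ(X, V)) (x : Γ(N, ⊤)) : ρ (r • x) = r • ρ x := by
    have := smul_restrict_fromSpec hV G ⊤ e₁.le r x
    refine (congrArg (res G e₁.ge) this).trans ?_
    rw [res_smul, ← CommRingCat.comp_apply, ← Functor.map_comp]
    have h : (homOfLE e₁.le).op ≫ (homOfLE e₁.ge).op = 𝟙 (Opposite.op V) := rfl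
    rw [h, CategoryTheory.Functor.map_id]
    rfl
  let π : Γ(N, ⊤) →ₗ[Γ(X, V)] (Γ(G, V) ⧸ A) := A.mkQ ∘ₗ { ρ with map_smul' := hρ }
  obtain ⟨T, hT, c, hc⟩ := exists_hom_of_linearMap _ N π
  -- The adjunct of the quotient map of the restriction of `G` to `V`.
  let φ : G ⟶ (pushforward hV.fromSpec).obj T :=
    (restrictAdjunction hV.fromSpec).unit.app G ≫ (pushforward hV.fromSpec).map c
  have hφ (U : X.Opens) (s : Γ(G, U)) :
      φ.app U s = c.app (hV.fromSpec ⁻¹ᵁ U)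
        ((G.restrictAppIso hV.fromSpec _).inv (res G (hV.fromSpec.image_preimage_le U) s)) := rfl
  refine ⟨_, φ, isPowTorsion_pushforward hV.fromSpec T hT, fun s => ?_, fun W s hs => ?_⟩
  · have hj : hV.fromSpec ⁻¹ᵁ V = ⊤ := hV.fromSpec_preimage_self
    have h₁ : c.app ⊤ ((G.restrictAppIso hV.fromSpec _).inv (res G e₁.le s)) = 0 ↔
        φ.app V s = 0 := by
      have h₂ := app_res c hj.ge ((G.restrictAppIso hV.fromSpec _).inv
        (res G (hV.fromSpec.image_preimage_le V) s))
      have h₃ : res N hj.ge ((G.restrictAppIso hV.fromSpec _).inv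
        (res G (hV.fromSpec.image_preimage_le V) s)) =
          (G.restrictAppIso hV.fromSpec _).inv (res G e₁.le s) := res_res G _ _ s
      rw [h₃, ← hφ] at h₂
      rw [h₂]
      refine ⟨fun h => ?_, fun h => (congrArg (res T hj.ge) h).trans (map_zero (res T hj.ge))⟩
      have h₄ := (congrArg (res T hj.le) h).trans (map_zero (res T hj.le))
      exact ((res_res T hj.ge hj.le _).trans (res_self T le_rfl _)).symm.trans h₄
    rw [← h₁, hc]
    have h₂ : ρ ((G.restrictAppIso hV.fromSpec _).inv (res G e₁.le s)) = s :=
      (res_res G e₁.le e₁.ge s).trans (res_self G _ s)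
    have h₃ : π ((G.restrictAppIso hV.fromSpec _).inv (res G e₁.le s)) = A.mkQ s :=
      congrArg A.mkQ h₂
    rw [h₃, Submodule.mkQ_apply, Submodule.Quotient.mk_eq_zero]
  -- The image of `fromSpec` is `V`, so a push-forward has the same sections over `W` and over `V ⊓
  -- W`.
  · have h : hV.fromSpec ⁻¹ᵁ W ≤ hV.fromSpec ⁻¹ᵁ (V ⊓ W) := by
      rw [Scheme.Hom.preimage_inf, hV.fromSpec_preimage_self]
      simp
    rw [app_res] at hs
    have h' := (congrArg (res T h) hs).trans (map_zero (res T h))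
    exact ((res_res T _ _ _).trans (res_self T le_rfl _)).symm.trans h'
end AdaptedDerived

/-! ### Finiteness is local; sections come from coherent sheaves. -/

namespace AdaptedDerived
open Scheme.Modules
variable {X Y : Scheme.{u}}

theorem exists_finset_basicOpen_cover [IsNoetherian X] {U : X.Opens} (hU : IsAffineOpen U)
    (V : X.Opens) (hV : V ≤ U) :
    ∃ S : Finset Γ(X, U), (∀ f ∈ S, X.basicOpen f ≤ V) ∧ V ≤ ⨆ f : S, X.basicOpen f.1 := by
  have hc : IsCompact (V : Set X) := TopologicalSpace.NoetherianSpace.isCompact _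
  obtain ⟨S, hS, hf, h⟩ := hc.elim_finite_subcover_image
    (b := {f : Γ(X, U) | X.basicOpen f ≤ V}) (c := fun f => (X.basicOpen f : Set X))
    (fun f _ => (X.basicOpen f).2) (fun x hx => by
      obtain ⟨f, hf, hx'⟩ := hU.exists_basicOpen_le (V := V) ⟨x, hx⟩ (hV hx)
      exact Set.mem_biUnion hf hx')
  refine ⟨hf.toFinset, fun f hf' => hS (hf.mem_toFinset.1 hf'), fun x hx => ?_⟩
  obtain ⟨f, hfS, hxf⟩ := Set.mem_iUnion₂.1 (h hx)
  exact TopologicalSpace.Opens.mem_iSup.2 ⟨⟨f, hf.mem_toFinset.2 hfS⟩, hxf⟩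

/-- Cover `U ⊓ V` by finitely many basic opens of `U`. On each `D(f)` some `f ^ n • s` extends to a
section `t f` over `U`, and `A` is spanned by these. In the quotient by `A` the section `s` dies on
every `D(f)`, because `f` is a unit there. -/
theorem exists_quotient_of_section [IsNoetherian X] (G : X.Modules) (hG : IsQcoh X G)
    {U : X.Opens} (hU : IsAffineOpen U) {V : X.Opens} (s : Γ(G, V)) :
    ∃ (Q : X.Modules) (φ : G ⟶ Q) (A : Submodule Γ(X, U) Γ(G, U)), IsPowTorsion Q ∧ A.FG ∧
      φ.app V s = 0 ∧ ∀ x : Γ(G, U), φ.app U x = 0 → x ∈ A := by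
  obtain ⟨S, hS, hV⟩ := exists_finset_basicOpen_cover hU (U ⊓ V) inf_le_left
  have h (f : S) := exists_res_eq_pow_smul G hG hU f.1
    (res G ((hS f.1 f.2).trans inf_le_right) s)
  choose n t ht using h
  obtain ⟨Q, φ, hQ, h₁, h₂⟩ := exists_quotient G hG hU
    (Submodule.span Γ(X, U) (Set.range t))
  refine ⟨Q, φ, _, hQ, Submodule.fg_span (Set.finite_range t), h₂ _ _ ?_, fun x => (h₁ x).1⟩
  refine eq_zero_of_res_eq_zero Q (fun f : S => X.basicOpen f.1) (fun f => hS f.1 f.2) hV _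
    fun f => ?_
  have h₃ : φ.app U (t f) = 0 := (h₁ _).2 (Submodule.subset_span ⟨f, rfl⟩)
  have h₄ := congrArg (φ.app (X.basicOpen f.1)) (ht f)
  rw [app_res, h₃, map_zero, Hom.app_smul, map_pow] at h₄
  rw [← app_res, res_res]
  exact (((isUnit_res_basicOpen f.1 le_rfl).pow _).smul_eq_zero.1 h₄.symm)

theorem finite_basicOpen (M : X.Modules) (hM : IsQcoh X M) {U : X.Opens} (hU : IsAffineOpen U)
    (f : Γ(X, U)) (h : Module.Finite Γ(X, U) Γ(M, U)) :
    Module.Finite Γ(X, X.basicOpen f) Γ(M, X.basicOpen f) := by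
  obtain ⟨S, hS⟩ := h
  classical
  refine ⟨S.image (res M (X.basicOpen_le f)), ?_⟩
  have key (x : Γ(M, U)) : res M (X.basicOpen_le f) x ∈ Submodule.span Γ(X, X.basicOpen f)
      (S.image (res M (X.basicOpen_le f)) : Set Γ(M, X.basicOpen f)) := by
    have hx : x ∈ Submodule.span Γ(X, U) (S : Set Γ(M, U)) := hS ▸ Submodule.mem_top
    induction hx using Submodule.span_induction with
    | mem x hx => exact Submodule.subset_span (Finset.mem_coe.2 (Finset.mem_image_of_mem _ hx))
    | zero => rw [map_zero]; exact zero_mem _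
    | add x y _ _ hx hy => rw [map_add]; exact add_mem hx hy
    | smul r x _ hx => rw [res_smul]; exact Submodule.smul_mem _ _ hx
  rw [eq_top_iff]
  intro t _
  obtain ⟨n, s, hs⟩ := exists_res_eq_pow_smul M hM hU f t
  have h₁ := key s
  rw [hs, map_pow] at h₁
  obtain ⟨v, hv⟩ := (isUnit_res_basicOpen f le_rfl).pow n
  rw [← hv] at h₁
  have h₂ := Submodule.smul_mem _ (↑v⁻¹ : Γ(X, X.basicOpen f)) h₁
  rwa [smul_smul, Units.inv_mul, one_smul] at h₂

theorem finite_of_basicOpen (M : X.Modules) (hM : IsQcoh X M) {U : X.Opens}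
    (hU : IsAffineOpen U) (S : Finset Γ(X, U)) (hS : Ideal.span (S : Set Γ(X, U)) = ⊤)
    (h : ∀ f : S, Module.Finite Γ(X, X.basicOpen f.1) Γ(M, X.basicOpen f.1)) :
    Module.Finite Γ(X, U) Γ(M, U) := by
  classical
  choose T hT using fun f : S => (h f).1
  choose n s hs using fun (f : S) (t : T f) => exists_res_eq_pow_smul M hM hU f.1 t.1
  -- Spanned by the numerators of the chosen generators over all `D(f)`.
  let N : Submodule Γ(X, U) Γ(M, U) := Submodule.span _ (Set.range fun p : Σ f, T f => s p.1 p.2)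
  suffices N = ⊤ by
    exact ⟨this ▸ Submodule.fg_span (Set.finite_range _)⟩
  rw [eq_top_iff]
  intro z _
  -- As the `f` generate the unit ideal, it is enough to move `z` into `N` by a power of each.
  refine N.mem_of_span_eq_top_of_smul_pow_mem _ hS z fun f => ?_
  have key (t : Γ(M, X.basicOpen f.1)) : ∃ (k : ℕ), ∃ y ∈ N, res M (X.basicOpen_le f.1) y =
      X.presheaf.map (homOfLE (X.basicOpen_le f.1)).op (f.1 ^ k) • t := by
    have ht : t ∈ Submodule.span Γ(X, X.basicOpen f.1) (T f : Set Γ(M, X.basicOpen f.1)) := 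
      hT f ▸ Submodule.mem_top
    induction ht using Submodule.span_induction with
    | mem x hx => exact ⟨n f ⟨x, hx⟩, s f ⟨x, hx⟩, Submodule.subset_span ⟨⟨f, ⟨x, hx⟩⟩, rfl⟩,
        hs f ⟨x, hx⟩⟩
    | zero => exact ⟨0, 0, zero_mem _, by rw [map_zero, smul_zero]⟩
    | add x y _ _ hx hy =>
      obtain ⟨k, x', hx', hx⟩ := hx
      obtain ⟨l, y', hy', hy⟩ := hy
      refine ⟨k + l, f.1 ^ l • x' + f.1 ^ k • y', add_mem (N.smul_mem _ hx') (N.smul_mem _ hy'), ?_⟩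
      rw [map_add, res_smul, res_smul, hx, hy, smul_smul, smul_smul, ← map_mul, ← map_mul,
        ← pow_add, ← pow_add, smul_add, add_comm l]
    | smul r x _ hx =>
      obtain ⟨k, x', hx', hx⟩ := hx
      obtain ⟨l, c, hc⟩ := exists_eq_pow_mul_of_isAffineOpen X U hU f.1 r
      refine ⟨l + k, c • x', N.smul_mem _ hx', ?_⟩
      have hc' : X.presheaf.map (homOfLE (X.basicOpen_le f.1)).op c =
        X.presheaf.map (homOfLE (X.basicOpen_le f.1)).op (f.1 ^ l) * r := by
        rw [map_pow]
        exact hc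
      rw [res_smul, hx, hc', smul_smul, smul_smul, pow_add, map_mul]
      congr 1
      ring
  obtain ⟨k, y, hy, h₁⟩ := key (res M (X.basicOpen_le f.1) z)
  obtain ⟨m, hm⟩ := exists_pow_smul_eq_zero M hM hU f.1 (f.1 ^ k • z - y) (by
    rw [map_sub, res_smul, h₁, sub_self])
  refine ⟨m + k, ?_⟩
  rw [smul_sub, sub_eq_zero, smul_smul, ← pow_add] at hm
  rw [hm]
  exact N.smul_mem _ hy

theorem exists_finset_affine_cover (X : Scheme.{u}) [IsNoetherian X] :
    ∃ S : Finset X.affineOpens, (⨆ U : S, U.1.1 : X.Opens) = ⊤ := by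
  have hc : IsCompact ((⊤ : X.Opens) : Set X) := TopologicalSpace.NoetherianSpace.isCompact _
  obtain ⟨S, hS, e⟩ := isCompact_iff_finite_and_eq_biUnion_affineOpens.mp hc
  refine ⟨hS.toFinset, ?_⟩
  rw [e, ← iSup_subtype'']
  refine le_antisymm (iSup_le fun U => ?_) (iSup_le fun U => ?_)
  · exact le_iSup (fun i : S => i.1.1) ⟨U.1, hS.mem_toFinset.1 U.2⟩
  · exact le_iSup (fun i : hS.toFinset => i.1.1) ⟨U.1, hS.mem_toFinset.2 U.2⟩

/-- Every section of a quasi-coherent sheaf on a noetherian scheme comes from a coherent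
sheaf. -/
theorem exists_coh_section [IsNoetherian X] (G : X.Modules) (hG : IsQcoh X G) {V : X.Opens}
    (s : Γ(G, V)) : ∃ (K : X.Modules) (k : K ⟶ G) (t : Γ(K, V)), IsCoh X K ∧ k.app V t = s := by
  obtain ⟨S, hS⟩ := exists_finset_affine_cover X
  choose Q φ A hQ hA hs hφ using fun U : S => exists_quotient_of_section G hG U.1.2 s
  obtain ⟨P, ψ, hP, hψ⟩ := exists_finset_inf Q φ hQ Finset.univ
  have hK : IsQcoh X (kernel ψ) := IsQcoh_kernel ψ hG hP
  obtain ⟨t, ht⟩ := exists_kernel_section ψ V s ((hψ V s).2 fun U _ => hs U)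
  refine ⟨kernel ψ, kernel.ι ψ, t, ⟨hK, fun U hU => ?_⟩, ht⟩
  -- Finiteness is tested on the cover: over its member `U` the sections of the kernel embed into `A
  -- U`, which is finite over a noetherian ring.
  refine of_affine_open_cover (P := fun U => Module.Finite Γ(X, U.1) Γ(kernel ψ, U.1))
    (fun U : S => U.1) hS ⟨U, hU⟩ (fun U f h => finite_basicOpen _ hK U.2 f h)
    (fun U S hS h => finite_of_basicOpen _ hK U.2 S hS h) fun U => ?_
  have : IsNoetherianRing Γ(X, U.1) := IsLocallyNoetherian.component_noetherian U.1
  have : Module.Finite Γ(X, U.1) (A U) := Module.Finite.iff_fg.2 (hA U)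
  refine Module.Finite.of_injective ((appLinear (kernel.ι ψ) U.1).codRestrict (A U) fun x => ?_)
    fun x y h => app_injective (kernel.ι ψ) U.1 (congrArg Subtype.val h)
  refine hφ U _ ((hψ _ _).1 ?_ U (Finset.mem_univ _))
  exact congr(($(kernel.condition ψ)).app U.1.1 x)
end AdaptedDerived

/-! ### Coherent sheaves dominating epimorphisms onto coherent sheaves. -/

namespace AdaptedDerived
open Scheme.Modules
variable {X Y : Scheme.{u}}

theorem exists_coh_finset_sections [IsNoetherian X] (G : X.Modules) (hG : IsQcoh X G)
    {ι : Type*} (V : ι → X.Opens) (s : ∀ i, Γ(G, V i)) (S : Finset ι) :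
    ∃ (K : X.Modules) (k : K ⟶ G), IsCoh X K ∧ ∀ i ∈ S, ∃ t : Γ(K, V i), k.app (V i) t = s i := by
  classical
  induction S using Finset.induction_on with
  | empty =>
    obtain ⟨Z, -, hZ⟩ := (IsCoh X).exists_prop_of_containsZero
    exact ⟨Z, 0, hZ, by simp⟩
  | insert i S hi ih =>
    obtain ⟨K, k, hK, h⟩ := ih
    obtain ⟨L, l, t, hL, ht⟩ := exists_coh_section G hG (s i)
    refine ⟨L ⊞ K, biprod.desc l k, IsCoh_biprod hL hK, ?_⟩
    rw [Finset.forall_mem_insert]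
    refine ⟨⟨(biprod.inl : L ⟶ L ⊞ K).app _ t, ?_⟩, fun j hj => ?_⟩
    · exact (congr(($(biprod.inl_desc l k)).app _ t)).trans ht
    · obtain ⟨t', ht'⟩ := h j hj
      exact ⟨(biprod.inr : K ⟶ L ⊞ K).app _ t', (congr(($(biprod.inr_desc l k)).app _ t')).trans ht'⟩

/-- Vanishing of sections over affine opens passes to basic opens, by localization, and back from
covers by them; every open is covered by affine ones. -/
theorem isZero_of_sections (M : X.Modules) (hM : IsQcoh X M) {ι : Type*} (U : ι → X.affineOpens)
    (hU : (⨆ i, (U i).1 : X.Opens) = ⊤) (h : ∀ i (s : Γ(M, (U i).1)), s = 0) : IsZero M := by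
  have h₁ (V : X.affineOpens) : ∀ s : Γ(M, V.1), s = 0 := by
    refine of_affine_open_cover (P := fun V => ∀ s : Γ(M, V.1), s = 0) U hU V
      (fun V f hV t => ?_) (fun V S hS hV s => ?_) h
    · obtain ⟨n, s, hs⟩ := exists_res_eq_pow_smul M hM V.2 f t
      rw [hV s, map_zero, map_pow] at hs
      have h₂ (t : Γ(M, X.basicOpen f)) (h : X.presheaf.map (homOfLE (X.basicOpen_le f)).op f ^ n •
          t = 0) : t = 0 :=
        ((isUnit_res_basicOpen f le_rfl).pow n).smul_eq_zero.1 h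
      exact h₂ t hs.symm
    · refine eq_zero_of_res_eq_zero M (fun f : S => X.basicOpen f.1) (fun f => X.basicOpen_le _)
        ?_ s fun f => hV f _
      exact (V.2.self_le_iSup_basicOpen_iff).2 hS
  have h₂ (W : X.Opens) (s : Γ(M, W)) : s = 0 := by
    refine eq_zero_of_res_eq_zero M (fun V : {V : X.affineOpens // V.1 ≤ W} => V.1.1)
      (fun V => V.2) (fun x hx => ?_) s fun V => h₁ V.1 _
    obtain ⟨_, ⟨V, hV, rfl⟩, hxV, hVW⟩ := X.isBasis_affineOpens.exists_subset_of_mem_open hx W.2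
    exact TopologicalSpace.Opens.mem_iSup.2 ⟨⟨⟨V, hV⟩, hVW⟩, hxV⟩
  rw [IsZero.iff_id_eq_zero]
  ext W s
  exact (h₂ W _).trans (h₂ W _).symm

theorem epi_of_app_surjective {M N : X.Modules} (hM : IsQcoh X M) (hN : IsQcoh X N) (g : M ⟶ N)
    {ι : Type*} (U : ι → X.affineOpens) (hU : (⨆ i, (U i).1 : X.Opens) = ⊤)
    (h : ∀ i, Function.Surjective (g.app (U i).1)) : Epi g := by
  have hC : IsQcoh X (cokernel g) := (IsQcoh X).prop_cokernel g hM hN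
  refine Preadditive.epi_of_isZero_cokernel g (isZero_of_sections _ hC U hU fun i s => ?_)
  obtain ⟨y, rfl⟩ := app_surjective hN hC (cokernel.π g) (U i).2 s
  obtain ⟨x, rfl⟩ := h i y
  exact congr(($(cokernel.condition g)).app (U i).1 x)

/-- On affine opens `p` is surjective on sections, so finitely many generators of `a` over a finite
affine cover lift to `b`. A coherent sheaf from which all these lifts come maps onto `a`. -/
theorem exists_coh_epi [IsNoetherian X] (b : Qcoh X) (a : Coh X) (p : b ⟶ (cohToQcoh X).obj a)
    [Epi p] : ∃ (a' : Coh X) (f : (cohToQcoh X).obj a' ⟶ b), Epi (f ≫ p) := by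
  obtain ⟨S, hS⟩ := exists_finset_affine_cover X
  have : PreservesFiniteColimits (IsQcoh X).ι := ι_preservesFiniteColimits _
  have : Epi p.hom := inferInstanceAs (Epi ((IsQcoh X).ι.map p))
  choose T hT using fun U : S => (a.property.2 U.1.1 U.1.2).1
  choose y hy using fun (U : S) (t : T U) => app_surjective b.property a.property.1 p.hom U.1.2 t.1
  obtain ⟨K, k, hK, h⟩ := exists_coh_finset_sections b.obj b.property
    (fun i : Σ U : S, T U => i.1.1.1) (fun i => y i.1 i.2) Finset.univ
  let a' : Coh X := ⟨K, hK⟩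
  let f : (cohToQcoh X).obj a' ⟶ b := ⟨k⟩
  refine ⟨a', f, (IsQcoh X).ι.epi_of_epi_map ?_⟩
  refine epi_of_app_surjective hK.1 a.property.1 (k ≫ p.hom) (fun U : S => U.1) hS fun U => ?_
  have : LinearMap.range (appLinear (k ≫ p.hom) U.1.1) = ⊤ := by
    rw [eq_top_iff, ← hT U, Submodule.span_le]
    intro t ht
    obtain ⟨z, hz⟩ := h ⟨U, ⟨t, ht⟩⟩ (Finset.mem_univ _)
    exact ⟨z, (congrArg (p.hom.app U.1.1) hz).trans (hy U ⟨t, ht⟩)⟩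
  exact LinearMap.range_eq_top.1 this
end AdaptedDerived

/-! ### Bijectivity on morphisms along distinguished triangles. -/

namespace AdaptedDerived
open Pretriangulated

section HomBijective

variable {D E : Type*} [Category* D] [Category* E]

/-- The map on morphisms `X ⟶ L` induced by a functor is bijective. -/
def HomBijective (F : D ⥤ E) (X L : D) : Prop :=
  Function.Bijective (F.map : (X ⟶ L) → _)

theorem HomBijective.of_iso (F : D ⥤ E) {X X' L L' : D} (e : X ≅ X') (i : L ≅ L')
    (h : HomBijective F X L) : HomBijective F X' L' := by
  refine ⟨fun f g hfg => ?_, fun f => ?_⟩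
  · have : e.hom ≫ f ≫ i.inv = e.hom ≫ g ≫ i.inv := h.1 (by simp [hfg])
    simpa using this
  · obtain ⟨g, hg⟩ := h.2 (F.map e.hom ≫ f ≫ F.map i.inv)
    exact ⟨e.inv ≫ g ≫ i.hom, by simp [hg]⟩

variable [HasShift D ℤ] [HasShift E ℤ] (F : D ⥤ E) [F.CommShift ℤ]

theorem HomBijective.shift {X L : D} (h : HomBijective F X L) (n : ℤ) :
    HomBijective F (X⟦n⟧) (L⟦n⟧) := by
  have key (f : X ⟶ L) : F.map (f⟦n⟧') =
      (F.commShiftIso n).hom.app X ≫ (F.map f)⟦n⟧' ≫ (F.commShiftIso n).inv.app L := by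
    have := (F.commShiftIso n).hom.naturality f
    dsimp at this
    rw [← reassoc_of% this, ← NatTrans.comp_app, Iso.hom_inv_id, NatTrans.id_app]
    simp
  refine ⟨fun f g hfg => ?_, fun f => ?_⟩
  · obtain ⟨f, rfl⟩ := (shiftFunctor D n).map_surjective f
    obtain ⟨g, rfl⟩ := (shiftFunctor D n).map_surjective g
    rw [key, key, cancel_epi, cancel_mono] at hfg
    rw [h.1 ((shiftFunctor E n).map_injective hfg)]
  · obtain ⟨g, hg⟩ := (shiftFunctor E n).map_surjective
      ((F.commShiftIso n).inv.app X ≫ f ≫ (F.commShiftIso n).hom.app L)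
    obtain ⟨g, rfl⟩ := h.2 g
    exact ⟨g⟦n⟧', by rw [key, hg]; simp⟩

variable [HasZeroObject D] [HasZeroObject E] [Preadditive D] [Preadditive E]
  [∀ n : ℤ, (shiftFunctor D n).Additive] [∀ n : ℤ, (shiftFunctor E n).Additive]
  [Pretriangulated D] [Pretriangulated E] [F.IsTriangulated]

/-- The five lemma for the long exact sequences of `Hom(X, -)`; the outer terms only need half of
bijectivity. -/
theorem HomBijective.of_triangle_right {X : D} (T : Triangle D) (hT : T ∈ distTriang D)
    (h₁ : Function.Surjective (F.map : (X ⟶ T.obj₁) → _)) (h₂ : HomBijective F X T.obj₂)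
    (h₃ : HomBijective F X (T.obj₁⟦(1 : ℤ)⟧))
    (h₄ : Function.Injective (F.map : (X ⟶ T.obj₂⟦(1 : ℤ)⟧) → _)) :
    HomBijective F X T.obj₃ := by
  have hF := F.map_distinguished T hT
  have : F.Additive := inferInstance
  have z₃₁ : (F.map T.mor₃ ≫ (F.commShiftIso (1 : ℤ)).hom.app T.obj₁) ≫ (F.map T.mor₁)⟦1⟧' = 0 :=
    comp_distTriang_mor_zero₃₁ _ hF
  have e₂ (f : F.obj X ⟶ F.obj T.obj₂) (hf : f ≫ F.map T.mor₂ = 0) :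
      ∃ g, f = g ≫ F.map T.mor₁ := Triangle.coyoneda_exact₂ _ hF f hf
  have e₃ (f : F.obj X ⟶ F.obj T.obj₃)
      (hf : f ≫ F.map T.mor₃ ≫ (F.commShiftIso (1 : ℤ)).hom.app T.obj₁ = 0) :
      ∃ g, f = g ≫ F.map T.mor₂ := Triangle.coyoneda_exact₃ _ hF f hf
  have nat : F.map (T.mor₁⟦1⟧') ≫ (F.commShiftIso (1 : ℤ)).hom.app T.obj₂ =
    (F.commShiftIso (1 : ℤ)).hom.app T.obj₁ ≫ (F.map T.mor₁)⟦1⟧' :=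
    (F.commShiftIso (1 : ℤ)).hom.naturality T.mor₁
  refine ⟨(injective_iff_map_eq_zero (F.mapAddHom : (X ⟶ T.obj₃) →+ _)).2 fun f hf => ?_,
    fun f => ?_⟩
  · have hf' : F.map f = 0 := hf
    obtain ⟨g, rfl⟩ := T.coyoneda_exact₃ hT f (h₃.1 (by simp [hf']))
    obtain ⟨c, hc⟩ := e₂ (F.map g) (by rw [← F.map_comp, hf'])
    obtain ⟨c, rfl⟩ := h₁ c
    have : g = c ≫ T.mor₁ := h₂.1 (by rw [hc, F.map_comp])
    rw [this, Category.assoc, comp_distTriang_mor_zero₁₂ _ hT, comp_zero]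
  · obtain ⟨h, hh⟩ := h₃.2 (f ≫ F.map T.mor₃)
    obtain ⟨k, rfl⟩ := T.coyoneda_exact₁ hT h (h₄ (by
      rw [F.map_comp, hh, F.map_zero, ← cancel_mono ((F.commShiftIso (1 : ℤ)).hom.app _),
        Category.assoc, Category.assoc, nat, zero_comp, ← Category.assoc (F.map T.mor₃), z₃₁,
        comp_zero]))
    obtain ⟨g, hg⟩ := e₃ (f - F.map k) (by
      rw [Preadditive.sub_comp, ← Category.assoc, ← Category.assoc, ← hh, F.map_comp, sub_self])
    obtain ⟨g, rfl⟩ := h₂.2 g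
    refine ⟨k + g ≫ T.mor₂, ?_⟩
    rw [F.map_add, F.map_comp, add_comm]
    exact (sub_eq_iff_eq_add.1 hg).symm

/-- The injective half of the effaceability argument: once `f` dies on `T.obj₂`, it comes from
`T.obj₁⟦1⟧`, where the comparison is already known. In the application this is one Ext degree lower.
-/
theorem eq_zero_of_triangle {L : D} (T : Triangle D) (hT : T ∈ distTriang D)
    (h₁ : Function.Surjective (F.map : (T.obj₂⟦(1 : ℤ)⟧ ⟶ L) → _))
    (h₃ : Function.Injective (F.map : (T.obj₁⟦(1 : ℤ)⟧ ⟶ L) → _)) (f : T.obj₃ ⟶ L)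
    (hf : T.mor₂ ≫ f = 0) (hf' : F.map f = 0) : f = 0 := by
  have hF := F.map_distinguished T hT
  have : F.Additive := inferInstance
  have e₂ (f : (F.obj T.obj₁)⟦(1 : ℤ)⟧ ⟶ F.obj L)
      (hf : (F.map T.mor₃ ≫ (F.commShiftIso (1 : ℤ)).hom.app T.obj₁) ≫ f = 0) :
      ∃ g, f = (-(F.map T.mor₁)⟦1⟧') ≫ g :=
    Triangle.yoneda_exact₂ _ (rot_of_distTriang _ (rot_of_distTriang _ hF)) f hf
  have nat : F.map (T.mor₁⟦1⟧') ≫ (F.commShiftIso (1 : ℤ)).hom.app T.obj₂ =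
    (F.commShiftIso (1 : ℤ)).hom.app T.obj₁ ≫ (F.map T.mor₁)⟦1⟧' :=
    (F.commShiftIso (1 : ℤ)).hom.naturality T.mor₁
  obtain ⟨g, rfl⟩ := T.yoneda_exact₃ hT f hf
  obtain ⟨c, hc⟩ := e₂ ((F.commShiftIso (1 : ℤ)).inv.app _ ≫ F.map g) (by
    rw [Category.assoc, Iso.hom_inv_id_app_assoc, ← hf', F.map_comp])
  obtain ⟨c', hc'⟩ := h₁ ((F.commShiftIso (1 : ℤ)).hom.app _ ≫ c)
  have : g = -T.mor₁⟦1⟧' ≫ c' := h₃ (by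
    have h₅ : F.map g = (F.commShiftIso (1 : ℤ)).hom.app _ ≫
        (F.commShiftIso (1 : ℤ)).inv.app _ ≫ F.map g := by
      rw [Iso.hom_inv_id_app_assoc]
    rw [h₅, hc, F.map_neg, F.map_comp, hc', reassoc_of% nat, Preadditive.neg_comp,
      Preadditive.comp_neg])
  rw [this, Preadditive.comp_neg, comp_distTriang_mor_zero₃₁_assoc _ hT, zero_comp, neg_zero]

/-- The surjective half: a morphism killed on `F.obj T.obj₂` factors through `F.obj T.obj₁` shifted
by one, where it can be lifted. -/
theorem exists_map_eq_of_triangle {L : D} (T : Triangle D) (hT : T ∈ distTriang D)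
    (h₃ : Function.Surjective (F.map : (T.obj₁⟦(1 : ℤ)⟧ ⟶ L) → _)) (f : F.obj T.obj₃ ⟶ F.obj L)
    (hf : F.map T.mor₂ ≫ f = 0) : ∃ g, F.map g = f := by
  have e₃ (f : F.obj T.obj₃ ⟶ F.obj L) (hf : F.map T.mor₂ ≫ f = 0) :
      ∃ g, f = (F.map T.mor₃ ≫ (F.commShiftIso (1 : ℤ)).hom.app T.obj₁) ≫ g :=
    Triangle.yoneda_exact₃ _ (F.map_distinguished T hT) f hf
  obtain ⟨g, hg⟩ := e₃ f hf
  obtain ⟨g', hg'⟩ := h₃ ((F.commShiftIso (1 : ℤ)).hom.app _ ≫ g)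
  exact ⟨T.mor₃ ≫ g', by rw [F.map_comp, hg', hg, Category.assoc]⟩

theorem HomBijective.of_triangle_left {L : D} (T : Triangle D) (hT : T ∈ distTriang D)
    (h₁ : Function.Surjective (F.map : (T.obj₂⟦(1 : ℤ)⟧ ⟶ L) → _)) (h₂ : HomBijective F T.obj₂ L)
    (h₃ : HomBijective F (T.obj₁⟦(1 : ℤ)⟧) L)
    (h₄ : Function.Injective (F.map : (T.obj₁ ⟶ L) → _)) :
    HomBijective F T.obj₃ L := by
  have : F.Additive := inferInstance
  have z₁₂ : F.map T.mor₁ ≫ F.map T.mor₂ = 0 :=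
    comp_distTriang_mor_zero₁₂ _ (F.map_distinguished T hT)
  refine ⟨(injective_iff_map_eq_zero (F.mapAddHom : (T.obj₃ ⟶ L) →+ _)).2 fun f hf => ?_,
    fun f => ?_⟩
  · have hf' : F.map f = 0 := hf
    exact eq_zero_of_triangle F T hT h₁ h₃.1 f (h₂.1 (by simp [hf'])) hf'
  · obtain ⟨h, hh⟩ := h₂.2 (F.map T.mor₂ ≫ f)
    obtain ⟨k, rfl⟩ := T.yoneda_exact₂ hT h (h₄ (by
      rw [F.map_comp, hh, F.map_zero, reassoc_of% z₁₂, zero_comp]))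
    obtain ⟨g, hg⟩ := exists_map_eq_of_triangle F T hT h₃.2 (f - F.map k) (by
      rw [Preadditive.comp_sub, ← hh, F.map_comp, sub_self])
    exact ⟨k + g, by rw [F.map_add, hg, add_sub_cancel]⟩

end HomBijective

/-! ### Dévissage of bounded objects. -/

section Generation

variable {C : Type*} [Category* C] [Abelian C] [HasDerivedCategory.{w₁} C]

open DerivedCategory DerivedCategory.TStructure

theorem prop_of_bounded (P : ObjectProperty (DerivedCategory C)) [P.IsClosedUnderIsomorphisms]
    [P.IsTriangulated] (hP : ∀ M : C, P ((singleFunctor C 0).obj M)) (K : DerivedCategory C)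
    (hK : t.bounded K) : P K := by
  have h₁ (b : ℤ) (K : DerivedCategory C) [K.IsGE b] [K.IsLE b] : P K := by
    obtain ⟨M, ⟨e⟩⟩ := exists_iso_singleFunctor_obj_of_isGE_of_isLE K b
    let i := ((singleFunctors C).shiftIso (-b) b 0 (by lia)).app M
    exact P.prop_of_iso (i ≪≫ e.symm) (P.le_shift (-b) _ (hP M))
  have h₂ (n : ℕ) : ∀ (a b : ℤ) (_ : b < a + n) (K : DerivedCategory C) (_ : K.IsGE a)
      (_ : K.IsLE b), P K := by
    induction n with
    | zero =>
      intro a b h K _ _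
      exact P.prop_of_isZero (t.isZero K b a (by lia))
    | succ n ih =>
      intro a b h K _ _
      -- Truncation splits off the top degree: `X` lives in `[a, b - 1]` and `Y` in degree `b`. The
      -- two missing bounds come from the rotated triangles.
      obtain ⟨X, Y, hX, hY, f, g, δ, hT⟩ := t.exists_triangle K (b - 1) b (by lia)
      have hX' : t.IsLE X (b - 1) := ⟨hX⟩
      have hY' : t.IsGE Y b := ⟨hY⟩
      by_cases hab : b < a
      · exact P.prop_of_isZero (t.isZero K b a hab)
      refine P.ext_of_isTriangulatedClosed₂ _ hT (ih a (b - 1) (by lia) X ?_ hX') ?_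
      · have h₃ : t.IsGE (Y⟦(-1 : ℤ)⟧) (b + 1) := t.isGE_shift Y b (-1) (b + 1) (by lia)
        have h₄ : t.IsGE (Y⟦(-1 : ℤ)⟧) a := t.isGE_of_ge _ _ (b + 1) (by lia)
        exact t.isGE₂ _ (inv_rot_of_distTriang _ hT) a h₄ ‹_›
      · have h₃ : t.IsLE (X⟦(1 : ℤ)⟧) (b - 2) := t.isLE_shift X (b - 1) 1 (b - 2) (by lia)
        have h₄ : t.IsLE (X⟦(1 : ℤ)⟧) b := t.isLE_of_le _ (b - 2) _ (by lia)
        have hY'' : t.IsLE Y b := t.isLE₂ _ (rot_of_distTriang _ hT) b ‹_› h₄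
        exact h₁ b Y
  obtain ⟨⟨a, ha⟩, ⟨b, hb⟩⟩ := hK
  exact h₂ (b - a + 1).toNat a b (by lia) K ha hb

/-- A property of objects that is closed under shifts and cones and holds for the objects of `C`
holds for all bounded objects. -/
theorem prop_of_bounded_of_cone (P : ObjectProperty (DerivedCategory C))
    [P.IsClosedUnderIsomorphisms]
    (shift : ∀ (K : DerivedCategory C) (_ : P K) (n : ℤ), P (K⟦n⟧))
    (cone : ∀ (T : Triangle (DerivedCategory C)) (_ : T ∈ distTriang (DerivedCategory C)),
      P T.obj₁ → P (T.obj₁⟦(1 : ℤ)⟧) → P T.obj₂ → P (T.obj₂⟦(1 : ℤ)⟧) → P T.obj₃)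
    (single : ∀ M : C, P ((singleFunctor C 0).obj M)) (K : DerivedCategory C)
    (hK : t.bounded K) : P K := by
  have : P.IsStableUnderShift ℤ := ⟨fun n => ⟨fun K hK => shift K hK n⟩⟩
  obtain ⟨Z, hZ⟩ : ∃ Z : C, IsZero Z := HasZeroObject.zero
  have : P.ContainsZero := ⟨_, (singleFunctor C 0).map_isZero hZ, single Z⟩
  have : P.IsTriangulatedClosed₃ := .mk' fun T hT h₁ h₂ =>
    cone T hT h₁ (shift _ h₁ 1) h₂ (shift _ h₂ 1)
  have : P.IsTriangulatedClosed₂ := .of_isTriangulatedClosed₃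
  have : P.IsTriangulated := { }
  exact prop_of_bounded P single K hK

end Generation
end AdaptedDerived

/-! ### Effaceability of classes of positive degree. -/

namespace AdaptedDerived
open Pretriangulated

section Effaceable

open DerivedCategory DerivedCategory.TStructure

variable {C : Type*} [Category* C] [Abelian C] [HasDerivedCategory.{w₁} C]

/-- Represent `f` by a roof with a quasi-isomorphism `s : X ⟶ M`, where `X` lives in degrees `≤ 0`.
The term of `X` in degree `0` maps onto `M`, and on it the other leg vanishes because its target
lives in degrees `≤ -1`. -/
theorem exists_epi_single_map_comp_eq_zero {M : C} {L : DerivedCategory C} [L.IsLE (-1)]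
    (f : (singleFunctor C 0).obj M ⟶ L) :
    ∃ (b : C) (p : b ⟶ M), Epi p ∧ (singleFunctor C 0).map p ≫ f = 0 := by
  obtain ⟨L', hL', ⟨e⟩⟩ := exists_iso_Q_obj_of_isLE L (-1)
  let S := HomologicalComplex.single C (.up ℤ) 0
  have hS (N : C) : CochainComplex.IsStrictlyLE (S.obj N) 0 :=
    inferInstanceAs (((CochainComplex.singleFunctor C 0).obj N).IsStrictlyLE 0)
  let f' : Q.obj (S.obj M) ⟶ Q.obj L' := f ≫ e.hom
  obtain ⟨X, hX, s, hs, g, hg⟩ := right_fac_of_isStrictlyLE f' 0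
  let i : S.obj (X.X 0) ⟶ X :=
    HomologicalComplex.mkHomFromSingle (𝟙 _) fun k hk =>
      (X.isZero_of_isStrictlyLE 0 k (by simp at hk; lia)).eq_of_tgt _ _
  let p : X.X 0 ⟶ M := s.f 0 ≫ (HomologicalComplex.singleObjXSelf (.up ℤ) 0 M).hom
  have his : S.map p = i ≫ s := by
    apply HomologicalComplex.from_single_hom_ext
    simp only [S, HomologicalComplex.single_map_f_self, p, i, HomologicalComplex.comp_f,
      HomologicalComplex.mkHomFromSingle_f, Category.assoc, Iso.hom_inv_id, Category.comp_id]
  have hig : i ≫ g = 0 := by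
    apply HomologicalComplex.from_single_hom_ext
    exact (L'.isZero_of_isStrictlyLE (-1) 0 (by lia)).eq_of_tgt _ _
  -- If `p ≫ t = 0`, then `s ≫ S.map t = 0`; as `s` becomes invertible and `singleFunctor` is
  -- faithful, `t = 0`.
  refine ⟨X.X 0, p, Preadditive.epi_of_cancel_zero _ fun {T} t ht => ?_, ?_⟩
  · have h₁ : s ≫ S.map t = 0 := by
      apply HomologicalComplex.to_single_hom_ext
      have h₂ : (s ≫ S.map t).f 0 = (p ≫ t) ≫
          (HomologicalComplex.singleObjXSelf (.up ℤ) 0 T).inv := by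
        simp only [S, p, HomologicalComplex.comp_f, HomologicalComplex.single_map_f_self,
          Category.assoc]
      rw [h₂, ht, zero_comp]
      rfl
    have h₃ : Q.map (S.map t) = 0 := by
      rw [← cancel_epi (Q.map s), ← Q.map_comp, h₁, Q.map_zero, comp_zero]
    exact (singleFunctor C 0).map_injective (h₃.trans ((singleFunctor C 0).map_zero _ _).symm)
  · have h₁ : Q.map (S.map p) ≫ f' = 0 := by
      rw [hg, his, Q.map_comp, Category.assoc, IsIso.hom_inv_id_assoc, ← Q.map_comp, hig,
        Q.map_zero]
    rw [← cancel_mono e.hom, zero_comp, Category.assoc]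
    exact h₁

end Effaceable

/-! ### Full faithfulness on bounded derived categories. -/

section FullyFaithful

open DerivedCategory DerivedCategory.TStructure

variable {A B : Type*} [Category* A] [Abelian A] [HasDerivedCategory.{w₁} A]
  [Category* B] [Abelian B] [HasDerivedCategory.{w₂} B]
  (Φ : A ⥤ B) [Φ.Additive] [PreservesFiniteLimits Φ] [PreservesFiniteColimits Φ]
  [Φ.Full] [Φ.Faithful]

theorem exists_epi_map_single_map_comp_eq_zero
    (hΦ : ∀ (b : B) (a : A) (p : b ⟶ Φ.obj a) [Epi p],
      ∃ (a' : A) (f : Φ.obj a' ⟶ b), Epi (f ≫ p))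
    {M : A} {L : DerivedCategory B} [L.IsLE (-1)]
    (f : Φ.mapDerivedCategory.obj ((singleFunctor A 0).obj M) ⟶ L) :
    ∃ (a : A) (q : a ⟶ M), Epi q ∧
      Φ.mapDerivedCategory.map ((singleFunctor A 0).map q) ≫ f = 0 := by
  let e := Φ.mapDerivedCategorySingleFunctor 0
  obtain ⟨b, p, hp, h⟩ := exists_epi_single_map_comp_eq_zero (e.inv.app M ≫ f)
  obtain ⟨a, g, hg⟩ := hΦ b M p
  obtain ⟨q, hq⟩ := Φ.map_surjective (g ≫ p)
  have : Epi (Φ.map q) := by rwa [hq]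
  refine ⟨a, q, Φ.epi_of_epi_map this, ?_⟩
  have nat : e.inv.app a ≫ Φ.mapDerivedCategory.map ((singleFunctor A 0).map q) =
    (singleFunctor B 0).map (Φ.map q) ≫ e.inv.app M := (e.inv.naturality q).symm
  rw [← cancel_epi (e.inv.app a), comp_zero, ← Category.assoc, nat, hq, Functor.map_comp,
    Category.assoc, Category.assoc, h, comp_zero]

theorem homBijective_single (M N : A) :
    HomBijective Φ.mapDerivedCategory ((singleFunctor A 0).obj M) ((singleFunctor A 0).obj N) := by
  let e := Φ.mapDerivedCategorySingleFunctor 0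
  have : (singleFunctor A 0 ⋙ Φ.mapDerivedCategory).Full := Functor.Full.of_iso e.symm
  have : (singleFunctor A 0 ⋙ Φ.mapDerivedCategory).Faithful := Functor.Faithful.of_iso e.symm
  refine ⟨fun f g h => ?_, fun f => ?_⟩
  · obtain ⟨f, rfl⟩ := (singleFunctor A 0).map_surjective f
    obtain ⟨g, rfl⟩ := (singleFunctor A 0).map_surjective g
    rw [(singleFunctor A 0 ⋙ Φ.mapDerivedCategory).map_injective h]
  · obtain ⟨g, hg⟩ := (singleFunctor A 0 ⋙ Φ.mapDerivedCategory).map_surjective f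
    exact ⟨_, hg⟩

instance (M : A) (n : ℤ) :
    (Φ.mapDerivedCategory.obj ((singleFunctor A n).obj M)).IsLE n :=
  have : ((singleFunctor B n).obj (Φ.obj M)).IsLE n := inferInstance
  t.isLE_of_iso (X := (singleFunctor B n).obj (Φ.obj M))
    ((Φ.mapDerivedCategorySingleFunctor n).symm.app M) n

instance (M : A) (n : ℤ) :
    (Φ.mapDerivedCategory.obj ((singleFunctor A n).obj M)).IsGE n :=
  have : ((singleFunctor B n).obj (Φ.obj M)).IsGE n := inferInstance
  t.isGE_of_iso (X := (singleFunctor B n).obj (Φ.obj M))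
    ((Φ.mapDerivedCategorySingleFunctor n).symm.app M) n

/-- Induction on the Ext degree. A class in degree `n + 1`, over `A` or over `B`, is killed by an
epimorphism `q : a ⟶ M` in `A`; the triangle of `kernel q ⟶ a ⟶ M` reduces the question to degree
`n`. -/
theorem homBijective_single_shift_nat
    (hΦ : ∀ (b : B) (a : A) (p : b ⟶ Φ.obj a) [Epi p],
      ∃ (a' : A) (f : Φ.obj a' ⟶ b), Epi (f ≫ p)) (N : A) (n : ℕ) :
    ∀ M : A, HomBijective Φ.mapDerivedCategory ((singleFunctor A 0).obj M)
      (((singleFunctor A 0).obj N)⟦(n : ℤ)⟧) := by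
  induction n with
  | zero =>
    intro M
    exact (homBijective_single Φ M N).of_iso _ (Iso.refl _)
      ((shiftFunctorZero (DerivedCategory A) ℤ).symm.app _)
  | succ n ih =>
    intro M
    let L := ((singleFunctor A 0).obj N)⟦((n + 1 : ℕ) : ℤ)⟧
    have hL : L.IsLE (-1) := by
      have : L.IsLE (-((n + 1 : ℕ) : ℤ)) := t.isLE_shift _ 0 _ _ (by lia)
      exact t.isLE_of_le _ (-((n + 1 : ℕ) : ℤ)) _ (by lia)
    have hL' : (Φ.mapDerivedCategory.obj L).IsLE (-1) := by
      have : ((Φ.mapDerivedCategory.obj ((singleFunctor A 0).obj N))⟦((n + 1 : ℕ) : ℤ)⟧).IsLE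
        (-((n + 1 : ℕ) : ℤ)) := t.isLE_shift _ 0 _ _ (by lia)
      have : (Φ.mapDerivedCategory.obj L).IsLE (-((n + 1 : ℕ) : ℤ)) :=
        t.isLE_of_iso (X := (Φ.mapDerivedCategory.obj ((singleFunctor A 0).obj N))⟦_⟧)
          ((Φ.mapDerivedCategory.commShiftIso ((n + 1 : ℕ) : ℤ)).symm.app _) _
      exact t.isLE_of_le _ (-((n + 1 : ℕ) : ℤ)) _ (by lia)
    have ih' (M' : A) : HomBijective Φ.mapDerivedCategory
        (((singleFunctor A 0).obj M')⟦(1 : ℤ)⟧) L :=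
      ((ih M').shift _ 1).of_iso _ (Iso.refl _)
        ((shiftFunctorAdd' (DerivedCategory A) (n : ℤ) 1 _ (by simp)).symm.app _)
    have hS {a : A} (q : a ⟶ M) [Epi q] : (ShortComplex.mk _ _ (kernel.condition q)).ShortExact :=
      { exact := ShortComplex.exact_kernel q
        mono_f := inferInstanceAs (Mono (kernel.ι q))
        epi_g := inferInstanceAs (Epi q) }
    refine ⟨(injective_iff_map_eq_zero (Φ.mapDerivedCategory.mapAddHom :
      ((singleFunctor A 0).obj M ⟶ L) →+ _)).2 fun f hf => ?_, fun f => ?_⟩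
    · obtain ⟨a, q, _, h⟩ := exists_epi_single_map_comp_eq_zero f
      exact eq_zero_of_triangle Φ.mapDerivedCategory _ (hS q).singleTriangle_distinguished
        (ih' _).2 (ih' _).1 f h hf
    · obtain ⟨a, q, _, h⟩ := exists_epi_map_single_map_comp_eq_zero Φ hΦ f
      exact exists_map_eq_of_triangle Φ.mapDerivedCategory _ (hS q).singleTriangle_distinguished
        (ih' _).2 f h

theorem homBijective_single_shift
    (hΦ : ∀ (b : B) (a : A) (p : b ⟶ Φ.obj a) [Epi p],
      ∃ (a' : A) (f : Φ.obj a' ⟶ b), Epi (f ≫ p)) (M N : A) (n : ℤ) :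
    HomBijective Φ.mapDerivedCategory ((singleFunctor A 0).obj M)
      (((singleFunctor A 0).obj N)⟦n⟧) := by
  obtain ⟨n, rfl⟩ | hn : (∃ m : ℕ, n = m) ∨ n < 0 := by
    rcases le_or_gt 0 n with h | h
    · exact .inl ⟨n.toNat, by lia⟩
    · exact .inr h
  · exact homBijective_single_shift_nat Φ hΦ N n M
  -- For negative `n` both groups of morphisms vanish, for degree reasons.
  have h₁ : (((singleFunctor A 0).obj N)⟦n⟧).IsGE (-n) := t.isGE_shift _ 0 _ _ (by lia)
  have h₂ : ((Φ.mapDerivedCategory.obj ((singleFunctor A 0).obj N))⟦n⟧).IsGE (-n) :=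
    t.isGE_shift _ 0 _ _ (by lia)
  have h₃ : (Φ.mapDerivedCategory.obj (((singleFunctor A 0).obj N)⟦n⟧)).IsGE (-n) :=
    t.isGE_of_iso (X := (Φ.mapDerivedCategory.obj ((singleFunctor A 0).obj N))⟦n⟧)
      ((Φ.mapDerivedCategory.commShiftIso n).symm.app _) _
  refine ⟨fun f g _ => ?_, fun f => ⟨0, ?_⟩⟩
  · exact (t.zero f 0 (-n) (by lia)).trans (t.zero g 0 (-n) (by lia)).symm
  · exact (t.zero _ 0 (-n) (by lia)).trans (t.zero f 0 (-n) (by lia)).symm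

/-- Dévissage in the target, with a shifted object of `A` as source, and then in the source. -/
theorem homBijective_of_bounded
    (hΦ : ∀ (b : B) (a : A) (p : b ⟶ Φ.obj a) [Epi p],
      ∃ (a' : A) (f : Φ.obj a' ⟶ b), Epi (f ≫ p)) (K L : DerivedCategory A)
    (hK : t.bounded K) (hL : t.bounded L) : HomBijective Φ.mapDerivedCategory K L := by
  let Ψ := Φ.mapDerivedCategory
  have hP (L : DerivedCategory A) (hL : t.bounded L) (M : A) (i : ℤ) :
      HomBijective Ψ (((singleFunctor A 0).obj M)⟦i⟧) L := by
    let P : ObjectProperty (DerivedCategory A) := fun L =>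
      ∀ (M : A) (i : ℤ), HomBijective Ψ (((singleFunctor A 0).obj M)⟦i⟧) L
    have : P.IsClosedUnderIsomorphisms := ⟨fun e h M i => (h M i).of_iso _ (Iso.refl _) e⟩
    refine prop_of_bounded_of_cone P (fun L hL n M i => ?_) (fun T hT h₁ h₁' h₂ h₂' M i => ?_)
      (fun N M i => ?_) L hL M i
    · exact ((hL M (i - n)).shift _ n).of_iso _
        ((shiftFunctorAdd' (DerivedCategory A) (i - n) n i (by lia)).symm.app _) (Iso.refl _)
    · exact .of_triangle_right _ T hT (h₁ M i).2 (h₂ M i) (h₁' M i) (h₂' M i).1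
    · refine ((homBijective_single_shift Φ hΦ M N (-i)).shift _ i).of_iso _ (Iso.refl _) ?_
      exact (shiftFunctorCompIsoId (DerivedCategory A) (-i) i (by lia)).app _
  let R : ObjectProperty (DerivedCategory A) := fun K =>
    ∀ L : DerivedCategory A, t.bounded L → HomBijective Ψ K L
  have : R.IsClosedUnderIsomorphisms := ⟨fun e h L hL => (h L hL).of_iso _ e (Iso.refl _)⟩
  refine prop_of_bounded_of_cone R (fun K hK n L hL => ?_) (fun T hT h₁ h₁' h₂ h₂' L hL => ?_)
    (fun M L hL => ?_) K hK L hL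
  · exact ((hK (L⟦-n⟧) (t.bounded.le_shift (-n) _ hL)).shift _ n).of_iso _ (Iso.refl _)
      ((shiftFunctorCompIsoId (DerivedCategory A) (-n) n (by lia)).app _)
  · exact .of_triangle_left _ T hT (h₂' L hL).2 (h₂ L hL) (h₁' L hL) (h₁ L hL).1
  · exact (hP L hL M 0).of_iso _ ((shiftFunctorZero (DerivedCategory A) ℤ).app _) (Iso.refl _)

end FullyFaithful
end AdaptedDerived

/-! ### Short exact sequences and pushouts. -/

namespace AdaptedDerived

section ShortExactSequences

variable {C : Type*} [Category* C] [Abelian C]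

/-- The sequence `0 ⟶ A ⟶ P ⟶ W ⟶ 0` with maps `i` and `p` is short exact. -/
def IsShortExact {A P W : C} (i : A ⟶ P) (p : P ⟶ W) : Prop :=
  ∃ w : i ≫ p = 0, (ShortComplex.mk i p w).ShortExact

namespace IsShortExact

variable {A A' P P' Q W : C}

theorem w {i : A ⟶ P} {p : P ⟶ W} (h : IsShortExact i p) : i ≫ p = 0 := h.1

theorem mono {i : A ⟶ P} {p : P ⟶ W} (h : IsShortExact i p) : Mono i := h.2.mono_f

theorem epi {i : A ⟶ P} {p : P ⟶ W} (h : IsShortExact i p) : Epi p := h.2.epi_g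

theorem exists_lift {i : A ⟶ P} {p : P ⟶ W} (h : IsShortExact i p) {T : C} (k : T ⟶ P)
    (hk : k ≫ p = 0) : ∃ l : T ⟶ A, l ≫ i = k :=
  have := h.mono
  ⟨h.2.exact.lift k hk, h.2.exact.lift_f k hk⟩

theorem exists_desc {i : A ⟶ P} {p : P ⟶ W} (h : IsShortExact i p) {T : C} (k : P ⟶ T)
    (hk : i ≫ k = 0) : ∃ l : W ⟶ T, p ≫ l = k :=
  have := h.epi
  ⟨h.2.exact.desc k hk, h.2.exact.g_desc k hk⟩

theorem of_desc {i : A ⟶ P} {p : P ⟶ W} [Mono i] [Epi p] (w : i ≫ p = 0)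
    (h : ∀ {T : C} (k : P ⟶ T), i ≫ k = 0 → ∃ l : W ⟶ T, p ≫ l = k) : IsShortExact i p :=
  ⟨w, ShortComplex.ShortExact.mk' (ShortComplex.exact_of_g_is_cokernel _
    (CokernelCofork.IsColimit.ofπ' p w fun k hk => ⟨(h k hk).choose, (h k hk).choose_spec⟩))
    inferInstance inferInstance⟩

theorem of_lift {i : A ⟶ P} {p : P ⟶ W} [Mono i] [Epi p] (w : i ≫ p = 0)
    (h : ∀ {T : C} (k : T ⟶ P), k ≫ p = 0 → ∃ l : T ⟶ A, l ≫ i = k) : IsShortExact i p :=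
  ⟨w, ShortComplex.ShortExact.mk' (ShortComplex.exact_of_f_is_kernel _
    (KernelFork.IsLimit.ofι' i w fun k hk => ⟨(h k hk).choose, (h k hk).choose_spec⟩))
    inferInstance inferInstance⟩

theorem of_mono (i : A ⟶ P) [Mono i] : IsShortExact i (cokernel.π i) :=
  of_desc (cokernel.condition i) fun k hk => ⟨cokernel.desc i k hk, cokernel.π_desc i k hk⟩

theorem iso_comp {i : A ⟶ P} {p : P ⟶ W} (h : IsShortExact i p) (e : A' ≅ A) :
    IsShortExact (e.hom ≫ i) p := by
  have := h.mono
  have := h.epi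
  refine of_desc (by rw [Category.assoc, h.w, comp_zero]) fun k hk => h.exists_desc k ?_
  rwa [Category.assoc, ← cancel_epi e.inv, e.inv_hom_id_assoc, comp_zero] at hk

theorem pushout {i : A ⟶ P} {p : P ⟶ W} (h : IsShortExact i p) {f : A ⟶ A'} {g : P ⟶ Q}
    {i' : A' ⟶ Q} (sq : IsPushout i f g i') : ∃ p' : Q ⟶ W, g ≫ p' = p ∧ IsShortExact i' p' := by
  have := h.mono
  have := h.epi
  have : Mono i' := (MorphismProperty.monomorphisms C).of_isPushout sq.flip (.infer_property i)
  let p' : Q ⟶ W := sq.desc p 0 (by rw [h.w, comp_zero])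
  have hp' : g ≫ p' = p := sq.inl_desc _ _ _
  have : Epi p' := epi_of_epi_fac hp'
  refine ⟨p', hp', of_desc (sq.inr_desc _ _ _) fun k hk => ?_⟩
  obtain ⟨l, hl⟩ := h.exists_desc (g ≫ k) (by rw [sq.w_assoc, hk, comp_zero])
  refine ⟨l, sq.hom_ext ?_ ?_⟩
  · rw [reassoc_of% hp', hl]
  · rw [hk, sq.inr_desc_assoc, zero_comp]

/-- The pushout of `P ⟶ P / A` along `P ⟶ P'` is `P' / A`. -/
theorem comp_pushout {a : A ⟶ P} {c : P ⟶ W} (h : IsShortExact a c) {i : P ⟶ P'} [Mono i]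
    {g : P' ⟶ Q} {i' : W ⟶ Q} (sq : IsPushout i c g i') : IsShortExact (a ≫ i) g := by
  have := h.mono
  have := h.epi
  have : Epi g := (MorphismProperty.epimorphisms C).of_isPushout sq (.infer_property c)
  refine of_desc (by rw [Category.assoc, sq.w, reassoc_of% h.w, zero_comp]) fun k hk => ?_
  obtain ⟨l, hl⟩ := h.exists_desc (i ≫ k) (by rw [← Category.assoc, hk])
  exact ⟨sq.desc k l hl.symm, sq.inl_desc _ _ _⟩

end IsShortExact

/-- The cokernel of `m` factors through `q` by a map vanishing on `W`. So an element of `J` whose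
image in `V` comes from `W` lies in `P`. -/
theorem isPullback_of_isPushout_of_mono {P W J V : C} {m : P ⟶ J} {p : P ⟶ W} {q : J ⟶ V}
    {n : W ⟶ V} [Mono m] (sq : IsPushout m p q n) : IsPullback m p q n := by
  have : Mono n := (MorphismProperty.monomorphisms C).of_isPushout sq.flip (.infer_property m)
  have hl (s : PullbackCone q n) : ∃ l, l ≫ m = s.fst :=
    (IsShortExact.of_mono m).exists_lift s.fst (by
      have h : q ≫ sq.desc (cokernel.π m) 0 (by rw [cokernel.condition, comp_zero]) =
        cokernel.π m := sq.inl_desc _ _ _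
      rw [← h, s.condition_assoc, sq.inr_desc, comp_zero])
  refine ⟨sq.toCommSq, ⟨PullbackCone.IsLimit.mk _ (fun s => (hl s).choose)
    (fun s => (hl s).choose_spec) (fun s => ?_) fun s l h _ => ?_⟩⟩
  · rw [← cancel_mono n, Category.assoc, ← sq.w, ← s.condition, ← Category.assoc,
      (hl s).choose_spec]
  · rw [← cancel_mono m, h, (hl s).choose_spec]

end ShortExactSequences

/-! ### Objects acyclic up to a given step. -/

section Acyclic

variable {C D : Type*} [Category* C] [Category* D] [Abelian C] (F : C ⥤ D)
  (I : ObjectProperty C)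

/-- `acyclicUpTo F I n A` says that the first `n` cosyzygies of `A`, computed with any
embeddings into objects of `I`, start short exact sequences that `F` preserves. -/
def acyclicUpTo : ℕ → ObjectProperty C
  | 0 => fun _ => True
  | n + 1 => fun A => ∀ {P W : C} (i : A ⟶ P) (p : P ⟶ W), IsShortExact i p →
      Epi (F.map p) ∧ (I P → acyclicUpTo n W)

theorem acyclicUpTo_of_iso {n : ℕ} {A B : C} (e : A ≅ B) (h : acyclicUpTo F I n A) :
    acyclicUpTo F I n B := by
  cases n with
  | zero => trivial
  | succ n => exact fun i p hip => h _ p (hip.iso_comp e)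

variable {F I} [Abelian D] [PreservesFiniteLimits F]

/-- The square is also a pullback, which the left exact `F` preserves, and epimorphisms are stable
under pullback. -/
theorem epi_map_of_isPushout {P W J V : C} {m : P ⟶ J} {p : P ⟶ W} {q : J ⟶ V}
    {n : W ⟶ V} [Mono m] (sq : IsPushout m p q n) [Epi (F.map q)] : Epi (F.map p) :=
  (MorphismProperty.epimorphisms D).of_isPullback
    ((isPullback_of_isPushout_of_mono sq).map F) (.infer_property (F.map q))

/-- It suffices to test embeddings into objects of `I`. -/
theorem epi_map_of_forall (hI : ∀ M : C, ∃ (J : C) (f : M ⟶ J), I J ∧ Mono f) {A : C}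
    (h : ∀ {J V : C} (i : A ⟶ J) (p : J ⟶ V), I J → IsShortExact i p → Epi (F.map p))
    {P W : C} (i : A ⟶ P) (p : P ⟶ W) (hip : IsShortExact i p) : Epi (F.map p) := by
  obtain ⟨J, m, hJ, _⟩ := hI P
  have := h (i ≫ m) _ hJ (hip.comp_pushout (IsPushout.of_hasPushout m p))
  exact epi_map_of_isPushout (IsPushout.of_hasPushout m p)

theorem shortExact_map_of_epi {A P W : C} {i : A ⟶ P} {p : P ⟶ W} (h : IsShortExact i p)
    [Epi (F.map p)] [F.PreservesZeroMorphisms] : IsShortExact (F.map i) (F.map p) := by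
  have := h.mono
  refine .of_lift (by rw [← F.map_comp, h.w, F.map_zero]) fun k hk => ?_
  have hl := isLimitForkMapOfIsLimit' F h.w h.2.fIsKernel
  exact ⟨hl.lift (KernelFork.ofι k hk), hl.fac (KernelFork.ofι k hk) .zero⟩

/-- The two closure properties are proved together because each inductive step needs the quotient
statement, and the second one also the extension statement. The quotient statement costs one extra
step of acyclicity of `A`. -/
theorem acyclicUpTo_closure [F.PreservesZeroMorphisms]
    (hI : ∀ M : C, ∃ (J : C) (f : M ⟶ J), I J ∧ Mono f)
    (hIR : ∀ (J : C) (n : ℕ), I J → acyclicUpTo F I n J) (n : ℕ) :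
    (∀ {A B W : C} (a : A ⟶ B) (c : B ⟶ W), IsShortExact a c → acyclicUpTo F I n A →
      acyclicUpTo F I n W → acyclicUpTo F I n B) ∧
    (∀ {A B W : C} (a : A ⟶ B) (c : B ⟶ W), IsShortExact a c → acyclicUpTo F I (n + 1) A →
      acyclicUpTo F I n B → acyclicUpTo F I n W) := by
  induction n with
  | zero => exact ⟨fun _ _ _ _ _ => trivial, fun _ _ _ _ _ => trivial⟩
  | succ n ih =>
    refine ⟨fun {A B V} a c hac hA hV P W i p hip => ?_, fun {A B V} a c hac hA hB => ?_⟩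
    · have := hip.mono
      -- The pushout is `P / A`: it is a cosyzygy of `A` and an extension of `W` by `V`.
      have sq := IsPushout.of_hasPushout i c
      have h₁ := hac.comp_pushout sq
      obtain ⟨p', hp', h₂⟩ := hip.pushout sq
      obtain ⟨_, hP⟩ := hA _ _ h₁
      obtain ⟨_, _⟩ := hV _ _ h₂
      refine ⟨?_, fun hPI => ih.2 _ _ h₂ hV (hP hPI)⟩
      rw [← hp', F.map_comp]
      infer_instance
    · have key : ∀ {J W : C} (i : V ⟶ J) (p : J ⟶ W), I J → IsShortExact i p →
          Epi (F.map p) ∧ acyclicUpTo F I n W := by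
        intro J W i p hJ hip
        -- Here `pushout b c` is `J' / A`, an extension of `J' / B` by `V`. Gluing it with `J` along
        -- `V` gives an object containing `J' / A` with quotient `W`, and `J` with quotient `J' /
        -- B`.
        obtain ⟨J', b, hJ', _⟩ := hI B
        have hb := IsShortExact.of_mono b
        have sq := IsPushout.of_hasPushout b c
        have h₁ := hac.comp_pushout sq
        obtain ⟨r, hr, h₂⟩ := hb.pushout sq
        have hQ₁ : acyclicUpTo F I (n + 1) (pushout b c) := (hA _ _ h₁).2 hJ'
        obtain ⟨hb₁, hb₂⟩ := hB _ _ hb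
        have := hip.mono
        have sq' := IsPushout.of_hasPushout i (pushout.inr b c)
        set g := pushout.inl i (pushout.inr b c)
        set h := pushout.inr i (pushout.inr b c)
        obtain ⟨q, hq, h₃⟩ := hip.pushout sq'
        obtain ⟨s, hs, h₄⟩ := h₂.pushout sq'.flip
        obtain ⟨_, -⟩ := hQ₁ _ _ h₃
        have hr' : Epi (F.map r) := by
          rw [← hr, F.map_comp] at hb₁
          exact epi_of_epi (F.map (pushout.inl b c)) (F.map r)
        have hs' : Epi (F.map s) := by
          rw [← hs, F.map_comp] at hr'
          exact epi_of_epi (F.map h) (F.map s)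
        refine ⟨Preadditive.epi_of_cancel_zero _ fun k hk => ?_,
          ih.2 _ _ h₃ hQ₁ (ih.1 _ _ h₄ (hIR _ _ hJ) (hb₂ hJ'))⟩
        rw [← hq, F.map_comp, Category.assoc] at hk
        -- As `k` dies on `F.obj J`, the map `F.map q ≫ k` factors through `F.map s`. On `J' / A` it
        -- is zero too, and `F.map r` is epi, so the factor `l` vanishes.
        obtain ⟨l, hl⟩ := (shortExact_map_of_epi (F := F) h₄).exists_desc _ hk
        have hl₀ : l = 0 := by
          rw [← cancel_epi (F.map r), comp_zero, ← hs, F.map_comp, Category.assoc, hl,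
            ← F.map_comp_assoc, h₃.w, F.map_zero, zero_comp]
        rw [← cancel_epi (F.map q), comp_zero, ← hl, hl₀, comp_zero]
      exact fun _ _ i p hip => ⟨epi_map_of_forall hI (fun i p hJ hip => (key i p hJ hip).1) i p hip,
        fun hP => (key i p hP hip).2⟩

end Acyclic
end AdaptedDerived

/-! ### Coresolutions, and the class of acyclic objects. -/

namespace AdaptedDerived

section Resolutions

variable {C D : Type*} [Category* C] [Category* D] [Abelian C] [Abelian D]

theorem IsShortExact.exact_comp_comp {A₀ A P W V : C} {i : A ⟶ P} {p : P ⟶ W}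
    (h : IsShortExact i p) {f : A₀ ⟶ A} [Epi f] {g : W ⟶ V} [Mono g]
    (w : (f ≫ i) ≫ p ≫ g = 0) : (ShortComplex.mk (f ≫ i) (p ≫ g) w).Exact := by
  rw [ShortComplex.exact_iff_exact_up_to_refinements]
  intro T x hx
  obtain ⟨l, hl⟩ := h.exists_lift x (by
    rwa [← cancel_mono g, Category.assoc, zero_comp])
  obtain ⟨T', π, _, y, hy⟩ := surjective_up_to_refinements_of_epi f l
  exact ⟨T', π, inferInstance, y, by rw [← hl, reassoc_of% hy]⟩

theorem exact_of_eq {A B E : C} {f f' : A ⟶ B} {g g' : B ⟶ E} {w : f ≫ g = 0}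
    (h : (ShortComplex.mk f g w).Exact) (hf : f = f') (hg : g = g') :
    (ShortComplex.mk f' g' (hf ▸ hg ▸ w)).Exact := by
  subst hf hg
  exact h

theorem cochainComplex_of_exactAt_iff (X : ℤ → C) (d : ∀ n, X n ⟶ X (n + 1))
    (sq : ∀ n, d n ≫ d (n + 1) = 0) (n : ℤ) :
    (CochainComplex.of X d sq).ExactAt (n + 1) ↔
      (ShortComplex.mk (d n) (d (n + 1)) (sq n)).Exact := by
  rw [HomologicalComplex.exactAt_iff' _ n (n + 1) (n + 1 + 1) (by simp) (by simp)]
  exact ⟨fun h => exact_of_eq h (CochainComplex.of_d ..) (CochainComplex.of_d ..),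
    fun h => exact_of_eq h (CochainComplex.of_d ..).symm (CochainComplex.of_d ..).symm⟩

variable (I : ObjectProperty C)

/-- A coresolution of `A 0` by objects of `I`, cut into short exact sequences. -/
structure Coresolution where
  A : ℕ → C
  J : ℕ → C
  i (n : ℕ) : A n ⟶ J n
  p (n : ℕ) : J n ⟶ A (n + 1)
  shortExact (n : ℕ) : IsShortExact (i n) (p n)
  mem (n : ℕ) : I (J n)

namespace Coresolution

variable {I}

/-- Extend a coresolution by a short exact sequence. -/
def cons (R : Coresolution I) {A J : C} (i : A ⟶ J) (p : J ⟶ R.A 0) (h : IsShortExact i p)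
    (hJ : I J) : Coresolution I where
  A := fun | 0 => A | n + 1 => R.A n
  J := fun | 0 => J | n + 1 => R.J n
  i := fun | 0 => i | n + 1 => R.i n
  p := fun | 0 => p | n + 1 => R.p n
  shortExact := fun | 0 => h | n + 1 => R.shortExact n
  mem := fun | 0 => hJ | n + 1 => R.mem n

theorem exists_of_enough (hI : ∀ M : C, ∃ (J : C) (f : M ⟶ J), I J ∧ Mono f) (A : C) :
    ∃ R : Coresolution I, R.A 0 = A := by
  choose J f hJ hf using hI
  let A' : ℕ → C := fun n => Nat.rec (motive := fun _ => C) A (fun _ B => cokernel (f B)) n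
  exact ⟨{ A := A'
           J := fun n => J (A' n)
           i := fun n => f (A' n)
           p := fun n => (cokernel.π (f (A' n)) : J (A' n) ⟶ cokernel (f (A' n)))
           shortExact := fun n => @IsShortExact.of_mono _ _ _ _ _ (f (A' n)) (hf (A' n))
           mem := fun n => hJ _ }, rfl⟩

variable (R : Coresolution I) (Z : C)

/-- The objects of the complex `A 0 ⟶ J 0 ⟶ J 1 ⟶ ⋯`. -/
def X : ℤ → C
  | .ofNat 0 => R.A 0
  | .ofNat (n + 1) => R.J n
  | .negSucc _ => Z

/-- The differentials of the complex `A 0 ⟶ J 0 ⟶ J 1 ⟶ ⋯`. -/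
def d : ∀ n : ℤ, R.X Z n ⟶ R.X Z (n + 1)
  | .ofNat 0 => R.i 0
  | .ofNat (n + 1) => R.p n ≫ R.i (n + 1)
  | .negSucc _ => 0

theorem d_comp_d : ∀ n : ℤ, R.d Z n ≫ R.d Z (n + 1) = 0
  | .ofNat 0 => by
    change R.i 0 ≫ R.p 0 ≫ R.i 1 = 0
    rw [reassoc_of% (R.shortExact 0).w, zero_comp]
  | .ofNat (n + 1) => by
    change (R.p n ≫ R.i (n + 1)) ≫ R.p (n + 1) ≫ R.i (n + 2) = 0
    rw [Category.assoc, reassoc_of% (R.shortExact (n + 1)).w, zero_comp, comp_zero]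
  | .negSucc _ => zero_comp

theorem acyclic (hZ : IsZero Z) : (CochainComplex.of (R.X Z) (R.d Z) (R.d_comp_d Z)).Acyclic := by
  have mono (n : ℕ) : Mono (R.i n) := (R.shortExact n).mono
  have epi (n : ℕ) : Epi (R.p n) := (R.shortExact n).epi
  intro n
  obtain ⟨n, rfl⟩ : ∃ m, n = m + 1 := ⟨n - 1, by lia⟩
  rw [cochainComplex_of_exactAt_iff]
  match n with
  | .ofNat 0 => 
    have h := (R.shortExact 0).exact_comp_comp (f := 𝟙 _) (g := R.i 1) (by
      rw [Category.id_comp, reassoc_of% (R.shortExact 0).w, zero_comp])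
    exact exact_of_eq h (Category.id_comp _) rfl
  | .ofNat (n + 1) =>
    exact IsShortExact.exact_comp_comp (f := R.p n) (g := R.i (n + 2)) (R.shortExact (n + 1))
      (R.d_comp_d Z (.ofNat (n + 1)))
  | .negSucc 0 => exact (ShortComplex.exact_iff_mono _ rfl).2 (mono 0)
  | .negSucc (n + 1) => exact ShortComplex.exact_of_isZero_X₂ _ hZ

variable (F : C ⥤ D) [F.Additive] [PreservesFiniteLimits F]

/-- As `R.A 0` is itself in `I`, the augmented coresolution is an acyclic complex of objects of `I`,
so `F` keeps it exact. Since `F` preserves the monomorphism `R.i (n + 1)`, exactness at `R.J (n +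
1)` says that `F.map (R.p n)` is epi. -/
theorem epi_map_of_adapted (hF : IsAdaptedClass F I) (h₀ : I (R.A 0)) (n : ℕ) :
    Epi (F.map (R.p n)) := by
  -- The terms in negative degrees must lie in `I` as well, so the zero object is taken from `I`.
  obtain ⟨Z, hZ, hIZ⟩ := hF.containsZero.exists_zero
  have hI : ∀ k : ℤ, I (R.X Z k)
    | .ofNat 0 => h₀
    | .ofNat (k + 1) => R.mem k
    | .negSucc _ => hIZ
  have hGE : (CochainComplex.of (R.X Z) (R.d Z) (R.d_comp_d Z)).IsStrictlyGE 0 := by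
    rw [CochainComplex.isStrictlyGE_iff]
    intro k hk
    match k with
    | .ofNat k => exact absurd hk (by simp)
    | .negSucc k => exact hZ
  -- With `R.A 0` in degree `0`, the object `R.J (n + 1)` sits in degree `n + 2`.
  have h := hF.map_acyclic _ ⟨0, hGE⟩ hI (R.acyclic Z hZ) (.ofNat (n + 1) + 1)
  rw [HomologicalComplex.exactAt_iff' _ (Int.ofNat (n + 1)) (Int.ofNat (n + 1) + 1)
    (Int.ofNat (n + 1) + 1 + 1) (by simp) (by simp)] at h
  have mono := (R.shortExact (n + 1)).mono
  have h' : (ShortComplex.mk (F.map (R.p n ≫ R.i (n + 1))) (F.map (R.p (n + 1) ≫ R.i (n + 2)))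
      (by rw [← F.map_comp, Category.assoc, reassoc_of% (R.shortExact (n + 1)).w, zero_comp,
        comp_zero, F.map_zero])).Exact :=
    exact_of_eq h (congrArg F.map (CochainComplex.of_d (R.X Z) (R.d Z) _))
      (congrArg F.map (CochainComplex.of_d (R.X Z) (R.d Z) _))
  rw [epi_iff_surjective_up_to_refinements]
  intro T y
  obtain ⟨T', π, hπ, x, hx⟩ := h'.exact_up_to_refinements (y ≫ F.map (R.i (n + 1))) (by
    have hw : R.i (n + 1) ≫ R.p (n + 1) ≫ R.i (n + 2) = 0 := by
      rw [reassoc_of% (R.shortExact (n + 1)).w, zero_comp]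
    dsimp
    rw [Category.assoc, ← F.map_comp]
    exact (congrArg (fun t => y ≫ F.map t) hw).trans (by rw [F.map_zero, comp_zero]))
  dsimp at x hx
  refine ⟨T', π, hπ, x, ?_⟩
  rwa [F.map_comp, ← Category.assoc, ← Category.assoc, cancel_mono] at hx

end Coresolution

variable {I} {F : C ⥤ D}

/-- The objects all of whose cosyzygies start short exact sequences that `F` preserves. -/
def acyclicClass (F : C ⥤ D) (I : ObjectProperty C) : ObjectProperty C := fun A => ∀ n, acyclicUpTo F I n A

instance : (acyclicClass F I).IsClosedUnderIsomorphisms where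
  of_iso e h n := acyclicUpTo_of_iso F I e (h n)

omit [Abelian D] in
theorem acyclicClass_epi_map {A P W : C} (hA : acyclicClass F I A) {i : A ⟶ P} {p : P ⟶ W}
    (h : IsShortExact i p) : Epi (F.map p) :=
  (hA 1 i p h).1

variable [PreservesFiniteLimits F]

/-- Any first embedding can be prolonged to a coresolution by `cons`, so a condition on all
coresolutions controls all choices of cosyzygies. -/
theorem acyclicUpTo_of_coresolutions (hI : ∀ M : C, ∃ (J : C) (f : M ⟶ J), I J ∧ Mono f) {A : C}
    (h : ∀ R : Coresolution I, R.A 0 = A → ∀ n, Epi (F.map (R.p n))) (n : ℕ) :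
    acyclicUpTo F I n A := by
  induction n generalizing A with
  | zero => trivial
  | succ n ih =>
    intro P W i p hip
    refine ⟨epi_map_of_forall hI (fun {J V} i p hJ hip => ?_) i p hip, fun hP => ih fun R hR k => ?_⟩
    · obtain ⟨R, rfl⟩ := Coresolution.exists_of_enough hI V
      exact h (R.cons i p hip hJ) rfl 0
    · subst hR
      exact h (R.cons i p hip hP) rfl (k + 1)

variable [F.Additive]

theorem acyclicClass_of_mem (hF : IsAdaptedClass F I) {A : C} (hA : I A) : acyclicClass F I A :=
  acyclicUpTo_of_coresolutions hF.exists_mono fun R hR n =>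
    R.epi_map_of_adapted F hF (hR ▸ hA) n

theorem acyclicClass_ext (hF : IsAdaptedClass F I) {A B W : C} {a : A ⟶ B} {c : B ⟶ W}
    (h : IsShortExact a c) (hA : acyclicClass F I A) (hW : acyclicClass F I W) :
    acyclicClass F I B := fun n =>
  (acyclicUpTo_closure hF.exists_mono (fun _ _ hJ => acyclicClass_of_mem hF hJ _) n).1 a c h
    (hA n) (hW n)

theorem acyclicClass_quotient (hF : IsAdaptedClass F I) {A B W : C} {a : A ⟶ B} {c : B ⟶ W}
    (h : IsShortExact a c) (hA : acyclicClass F I A) (hB : acyclicClass F I B) :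
    acyclicClass F I W := fun n =>
  (acyclicUpTo_closure hF.exists_mono (fun _ _ hJ => acyclicClass_of_mem hF hJ _) n).2 a c h
    (hA (n + 1)) (hB n)

theorem acyclicClass_of_isZero (hF : IsAdaptedClass F I) {A : C} (hA : IsZero A) :
    acyclicClass F I A := by
  obtain ⟨Z, hZ, hIZ⟩ := hF.containsZero.exists_zero
  exact (acyclicClass F I).prop_of_iso (hZ.iso hA) (acyclicClass_of_mem hF hIZ)

end Resolutions
end AdaptedDerived

/-! ### Acyclic bounded below complexes of acyclic objects. -/

namespace AdaptedDerived

section AcyclicComplexes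

variable {C D : Type*} [Category* C] [Category* D] [Abelian C] [Abelian D]

theorem isShortExact_cycles {K : CochainComplex C ℤ} (hK : K.Acyclic) (n : ℤ) :
    IsShortExact (K.iCycles n) (K.toCycles n (n + 1)) := by
  have h := (K.exactAt_iff' n (n + 1) (n + 1 + 1) (by simp) (by simp)).1 (hK (n + 1))
  have h₀ : K.iCycles n ≫ K.toCycles n (n + 1) = 0 := by
    rw [← cancel_mono (K.iCycles (n + 1)), Category.assoc, K.toCycles_i, K.iCycles_d, zero_comp]
  have : Epi (K.toCycles n (n + 1)) := by
    rw [epi_iff_surjective_up_to_refinements]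
    intro T y
    have h' : ∃ (T' : C) (π : T' ⟶ T) (_ : Epi π) (x : T' ⟶ K.X n),
        π ≫ y ≫ K.iCycles (n + 1) = x ≫ K.d n (n + 1) :=
      h.exact_up_to_refinements (y ≫ K.iCycles (n + 1)) (by
        have : (y ≫ K.iCycles (n + 1)) ≫ K.d (n + 1) (n + 1 + 1) = 0 := by
          rw [Category.assoc, K.iCycles_d, comp_zero]
        exact this)
    obtain ⟨T', π, hπ, x, hx⟩ := h'
    refine ⟨T', π, hπ, x, ?_⟩
    rw [← cancel_mono (K.iCycles (n + 1)), Category.assoc, Category.assoc, K.toCycles_i, hx]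
  refine .of_lift h₀ fun k hk => ⟨K.liftCycles k (n + 1) (by simp) ?_, K.liftCycles_i _ _ _ _⟩
  rw [← K.toCycles_i, reassoc_of% hk, zero_comp]

variable {F : C ⥤ D} [F.Additive] [PreservesFiniteLimits F] {I : ObjectProperty C}

/-- Below the bound the cycles are zero; above it each is the quotient of a term by the preceding
cycles, so closure under quotients propagates upwards. -/
theorem acyclicClass_cycles (hF : IsAdaptedClass F I) {K : CochainComplex C ℤ} (hK : K.Acyclic)
    (hI : ∀ n, acyclicClass F I (K.X n)) (m : ℤ) [K.IsStrictlyGE m] (n : ℤ) :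
    acyclicClass F I (K.cycles n) := by
  obtain hn | hn := lt_or_ge n m
  · exact acyclicClass_of_isZero hF (IsZero.of_mono (K.iCycles n) (K.isZero_of_isStrictlyGE m n hn))
  · obtain ⟨n, rfl⟩ : ∃ k, n = k + 1 := ⟨n - 1, by lia⟩
    replace hn : m - 1 ≤ n := by lia
    induction n, hn using Int.leInduction with
    | base =>
      refine acyclicClass_quotient hF (isShortExact_cycles hK (m - 1)) ?_ (hI _)
      exact acyclicClass_of_isZero hF (IsZero.of_mono (K.iCycles (m - 1))
        (K.isZero_of_isStrictlyGE m (m - 1) (by lia)))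
    | succ n hn ih => exact acyclicClass_quotient hF (isShortExact_cycles hK (n + 1)) ih (hI _)

theorem map_acyclic_of_acyclicClass (hF : IsAdaptedClass F I) {K : CochainComplex C ℤ}
    (hK : K.Acyclic) (hI : ∀ n, acyclicClass F I (K.X n)) (m : ℤ) [K.IsStrictlyGE m] :
    ((F.mapHomologicalComplex (ComplexShape.up ℤ)).obj K).Acyclic := by
  intro n
  obtain ⟨n, rfl⟩ : ∃ k, n = k + 1 := ⟨n - 1, by lia⟩
  rw [HomologicalComplex.exactAt_iff' _ n (n + 1) (n + 1 + 1) (by simp) (by simp)]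
  have (k : ℤ) : Epi (F.map (K.toCycles k (k + 1))) :=
    acyclicClass_epi_map (acyclicClass_cycles hF hK hI m k) (isShortExact_cycles hK k)
  have hd (k : ℤ) : F.map (K.toCycles k (k + 1)) ≫ F.map (K.iCycles (k + 1)) =
      F.map (K.d k (k + 1)) := by
    rw [← F.map_comp, K.toCycles_i]
  have h := (shortExact_map_of_epi (F := F) (isShortExact_cycles hK (n + 1))).exact_comp_comp
    (f := F.map (K.toCycles n (n + 1))) (g := F.map (K.iCycles (n + 1 + 1))) (by
      rw [hd, hd, ← F.map_comp, K.d_comp_d, F.map_zero])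
  exact exact_of_eq h (hd _) (hd _)

end AcyclicComplexes

/-! ### Quasi-isomorphisms to complexes with terms in `I`. -/

section Resolution

variable {C : Type*} [Category* C] [Abelian C]

/-- A stage in the construction of a resolution of the complex `K` by objects of `I`:
a factorization of the differential through an object `P` together with an embedding of `P`
into an object of `I`. -/
structure ResolutionStage (I : ObjectProperty C) (K : CochainComplex C ℤ) (n : ℤ) where
  P : C
  J : C
  u : K.X n ⟶ P
  v : P ⟶ K.X (n + 1)
  m : P ⟶ J
  u_v : u ≫ v = K.d n (n + 1)
  v_d : v ≫ K.d (n + 1) (n + 1 + 1) = 0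
  mono : Mono m
  mem : I J

namespace ResolutionStage

variable {I : ObjectProperty C} {K : CochainComplex C ℤ} {n : ℤ}

/-- The compatibility of consecutive stages in the construction of a resolution. -/
def Rel (s : ResolutionStage I K n) (t : ResolutionStage I K (n + 1)) : Prop :=
  ∃ r : s.J ⟶ t.P, IsPushout s.v s.m t.u r ∧ r ≫ t.v = 0

/-- The next `P` glues the next term of `K` to `J` along the current `P`; its map `v` is the
differential on `K` and zero on `J`. -/
theorem exists_rel (hI : ∀ M : C, ∃ (J : C) (f : M ⟶ J), I J ∧ Mono f)
    (s : ResolutionStage I K n) : ∃ t : ResolutionStage I K (n + 1), s.Rel t := by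
  obtain ⟨J, m, hJ, hm⟩ := hI (pushout s.v s.m)
  have sq := IsPushout.of_hasPushout s.v s.m
  refine ⟨{ P := pushout s.v s.m
            J := J
            u := pushout.inl s.v s.m
            v := pushout.desc (K.d _ _) 0 (by rw [s.v_d, comp_zero])
            m := m
            u_v := pushout.inl_desc _ _ _
            v_d := sq.hom_ext ?_ ?_
            mono := hm
            mem := hJ }, pushout.inr s.v s.m, sq, pushout.inr_desc _ _ _⟩
  · rw [pushout.inl_desc_assoc, K.d_comp_d, comp_zero]
  · rw [pushout.inr_desc_assoc, zero_comp, comp_zero]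

theorem exists_family (hI : ∀ M : C, ∃ (J : C) (f : M ⟶ J), I J ∧ Mono f) {Z : C} (hZ : IsZero Z)
    (hIZ : I Z) [K.IsStrictlyGE 0] : ∃ s : ∀ n, ResolutionStage I K n,
      (∀ n, (s n).Rel (s (n + 1))) ∧ ∀ n, n < 0 → IsZero (s n).J := by
  choose next hnext using fun (n : ℤ) (s : ResolutionStage I K n) => s.exists_rel hI
  let z (n : ℤ) (hn : n < 0) : ResolutionStage I K n :=
    { P := Z
      J := Z
      u := 0
      v := 0
      m := 𝟙 Z
      u_v := (K.isZero_of_isStrictlyGE 0 n hn).eq_of_src _ _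
      v_d := zero_comp
      mono := inferInstance
      mem := hIZ }
  let s : ∀ n, ResolutionStage I K n
    | .ofNat n => Nat.rec (motive := fun n => ResolutionStage I K (.ofNat n))
        (next (-1) (z (-1) (by decide))) (fun n s => next (.ofNat n) s) n
    | .negSucc n => z _ (Int.negSucc_lt_zero n)
  refine ⟨s, fun n => ?_, fun n hn => ?_⟩
  · match n with
    | .ofNat n => exact hnext _ _
    | .negSucc 0 => exact hnext _ _
    -- Both stages are in negative degrees, where all objects are zero and the square is trivially a
    -- pushout.
    | .negSucc (n + 1) =>
      have h : IsZero (K.X (.negSucc n)) := K.isZero_of_isStrictlyGE 0 _ (Int.negSucc_lt_zero n)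
      have : IsIso (0 : K.X (.negSucc n) ⟶ Z) := ⟨0, h.eq_of_src _ _, hZ.eq_of_src _ _⟩
      have : IsIso (s (Int.negSucc (n + 1) + 1)).u := this
      have : IsIso (s (Int.negSucc (n + 1))).m := inferInstanceAs (IsIso (𝟙 Z))
      exact ⟨𝟙 Z, IsPushout.of_vert_isIso ⟨hZ.eq_of_src _ _⟩, hZ.eq_of_src _ _⟩
  · match n with
    | .ofNat n => exact absurd hn (by simp)
    | .negSucc n => exact hZ

/-- Each pushout square is also a pullback, since `m` is mono. The pullback property turns relations
in the next `P` into elements `z` of the current one, and the pushout property writes `z` as a part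
from `K` plus a part from `J`. Applying `v` kills the part from `J`, which gives injectivity on
cohomology; applying `m` gives surjectivity. -/
theorem exists_quasiIso_of_family (s : ∀ n, ResolutionStage I K n)
    (hs : ∀ n, (s n).Rel (s (n + 1))) :
    ∃ (L : CochainComplex C ℤ) (f : K ⟶ L), (∀ n, L.X n = (s n).J) ∧ QuasiIso f := by
  choose r sq hr using hs
  have hw (n : ℤ) : (s n).v ≫ (s (n + 1)).u = (s n).m ≫ r n := (sq n).w
  let d (n : ℤ) : (s n).J ⟶ (s (n + 1)).J := r n ≫ (s (n + 1)).m
  let L : CochainComplex C ℤ := CochainComplex.of (fun n => (s n).J) d fun n => by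
    dsimp only [d]
    rw [Category.assoc, ← reassoc_of% (hw (n + 1)), reassoc_of% (hr n), zero_comp]
  have hd (n : ℤ) : L.d n (n + 1) = r n ≫ (s (n + 1)).m := CochainComplex.of_d _ d n
  let f : K ⟶ L :=
    { f := fun n => (s n).u ≫ (s n).m
      comm' := fun i j hij => by
        obtain rfl : i + 1 = j := hij
        rw [hd, Category.assoc, ← reassoc_of% (hw i), reassoc_of% (s i).u_v] }
  have hf (n : ℤ) : f.f n = (s n).u ≫ (s n).m := rfl
  have hmono (n : ℤ) : Mono (s n).m := (s n).mono
  have hdecomp (n : ℤ) {T : C} (z : T ⟶ (s (n + 1)).P) :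
      ∃ (T' : C) (π : T' ⟶ T) (_ : Epi π) (k : T' ⟶ K.X (n + 1)) (j : T' ⟶ L.X n),
        π ≫ z = k ≫ (s (n + 1)).u + j ≫ r n :=
    (sq n).hom_eq_add_up_to_refinements z
  refine ⟨L, f, fun n => rfl, ⟨fun n => ?_⟩⟩
  obtain ⟨n, rfl⟩ : ∃ k, n = k + 1 + 1 := ⟨n - 2, by lia⟩
  rw [quasiIsoAt_iff_isIso_homologyMap]
  have : Mono (HomologicalComplex.homologyMap f (n + 1 + 1)) := by
    rw [HomologicalComplex.mono_homologyMap_iff_up_to_refinements f (n + 1) (n + 1 + 1)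
      (n + 1 + 1 + 1) (by simp) (by simp)]
    intro T x hx y hy
    have hxy : y ≫ r (n + 1) = x ≫ (s (n + 1 + 1)).u := by
      rw [← cancel_mono (s (n + 1 + 1)).m, Category.assoc, Category.assoc, ← hd, ← hf, hy]
    obtain ⟨z, -, hz⟩ := (isPullback_of_isPushout_of_mono (sq (n + 1)).flip).exists_lift y x hxy
    obtain ⟨T', π, hπ, k, j, h⟩ := hdecomp n z
    refine ⟨T', π, hπ, k, ?_⟩
    rw [← hz, reassoc_of% h, Preadditive.add_comp, Category.assoc, Category.assoc, hr, comp_zero,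
      add_zero, (s (n + 1)).u_v]
  have : Epi (HomologicalComplex.homologyMap f (n + 1 + 1)) := by
    rw [HomologicalComplex.epi_homologyMap_iff_up_to_refinements f (n + 1) (n + 1 + 1)
      (n + 1 + 1 + 1) (by simp) (by simp)]
    intro T y hy
    have hy' : y ≫ r (n + 1 + 1) = 0 ≫ (s (n + 1 + 1 + 1)).u := by
      rw [← cancel_mono (s (n + 1 + 1 + 1)).m, Category.assoc, ← hd, hy, zero_comp, zero_comp]
    obtain ⟨z, hz, hz'⟩ :=
      (isPullback_of_isPushout_of_mono (sq (n + 1 + 1)).flip).exists_lift y 0 hy'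
    obtain ⟨T', π, hπ, k, j, h⟩ := hdecomp (n + 1) z
    refine ⟨T', π, hπ, k, ?_, j, ?_⟩
    · have := h =≫ (s (n + 1 + 1)).v
      rw [Category.assoc, hz', comp_zero, Preadditive.add_comp, Category.assoc, Category.assoc, hr,
        comp_zero, add_zero, (s (n + 1 + 1)).u_v] at this
      exact this.symm
    · rw [← hz, reassoc_of% h, Preadditive.add_comp, Category.assoc, Category.assoc, hf, hd]
  exact isIso_of_mono_of_epi _

end ResolutionStage

theorem exists_quasiIso_of_enough {I : ObjectProperty C} [I.ContainsZero]
    (hI : ∀ M : C, ∃ (J : C) (f : M ⟶ J), I J ∧ Mono f) (K : CochainComplex C ℤ) (m : ℤ)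
    [K.IsStrictlyGE m] : ∃ (L : CochainComplex C ℤ) (f : K ⟶ L), L.IsStrictlyGE m ∧
      (∀ n, I (L.X n)) ∧ QuasiIso f := by
  have key (K : CochainComplex C ℤ) [K.IsStrictlyGE 0] :
      ∃ (L : CochainComplex C ℤ) (f : K ⟶ L), L.IsStrictlyGE 0 ∧ (∀ n, I (L.X n)) ∧
        QuasiIso f := by
    obtain ⟨Z, hZ, hIZ⟩ := I.exists_prop_of_containsZero
    obtain ⟨s, hs, hs₀⟩ := ResolutionStage.exists_family (K := K) hI hZ hIZ
    obtain ⟨L, f, hL, hf⟩ := ResolutionStage.exists_quasiIso_of_family s hs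
    refine ⟨L, f, ?_, fun n => hL n ▸ (s n).mem, hf⟩
    rw [CochainComplex.isStrictlyGE_iff]
    exact fun n hn => hL n ▸ hs₀ n hn
  have := K.isStrictlyGE_shift m m 0 (by lia)
  obtain ⟨L, f, hL, hIL, hf⟩ := key (K⟦m⟧)
  refine ⟨L⟦-m⟧, (shiftFunctorCompIsoId (CochainComplex C ℤ) m (-m) (by lia)).inv.app K ≫ f⟦-m⟧',
    L.isStrictlyGE_shift 0 (-m) m (by lia), fun n => hIL _, ?_⟩
  have := (CochainComplex.quasiIso_shift_iff f (-m)).2 hf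
  infer_instance

end Resolution
end AdaptedDerived

/-! ### Right derivability structures from resolutions. -/

namespace AdaptedDerived
open Pretriangulated

section Derivability

variable {H : Type*} [Category* H] [Preadditive H] [HasZeroObject H] [HasShift H ℤ]
  [∀ n : ℤ, (shiftFunctor H n).Additive] [Pretriangulated H] [IsTriangulated H]
  (T N : ObjectProperty H) [T.IsTriangulated] [N.IsTriangulated] [N.IsClosedUnderIsomorphisms]

/-- After resolving the target of `s`, the composite joins two objects of `T`, so its cone can be
taken in `T`; it also lies in `N`. -/
theorem isVerdierRightLocalizing_of_resolutions
    (h : ∀ X : H, ∃ (Z : H) (s : X ⟶ Z), T Z ∧ N.trW s) : T.IsVerdierRightLocalizing N := by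
  rw [ObjectProperty.isVerdierRightLocalizing_iff]
  intro X Y s hX hs
  obtain ⟨Z, t, hZ, ht⟩ := h Y
  obtain ⟨U, hU, a, b, hT⟩ := T.distinguished_cocone_triangle (s ≫ t) hX hZ
  have hst : N.trW (s ≫ t) := N.trW.comp_mem _ _ hs ht
  refine ⟨Z, s ≫ t, t, hZ, ?_, rfl⟩
  rw [ObjectProperty.trW_iff]
  exact ⟨U, a, b, hT, hU, (N.trW_iff_of_distinguished _ hT).1 hst⟩

omit [T.IsTriangulated] [N.IsClosedUnderIsomorphisms] in
-- The Ore condition completes the square, and its new corner is then resolved.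
theorem exists_square_of_resolutions (h : ∀ X : H, ∃ (Z : H) (s : X ⟶ Z), T Z ∧ N.trW s)
    {X Y Z : H} (s : X ⟶ Z) (hs : N.trW s) (f : X ⟶ Y) :
    ∃ (V : T.FullSubcategory) (g : Z ⟶ V.obj) (t : Y ⟶ V.obj), N.trW t ∧ f ≫ t = s ≫ g := by
  obtain ⟨φ, hφ⟩ := (MorphismProperty.RightFraction.mk s hs f).exists_leftFraction
  obtain ⟨V, t, hV, ht⟩ := h φ.Y'
  exact ⟨⟨V, hV⟩, φ.f ≫ t, φ.s ≫ t, N.trW.comp_mem _ _ φ.hs ht, by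
    simpa using hφ =≫ t⟩

omit [N.IsClosedUnderIsomorphisms] in
theorem hasRightResolutions_arrow (h : ∀ X : H, ∃ (Z : H) (s : X ⟶ Z), T Z ∧ N.trW s) :
    (T.triangulatedLocalizerMorphism N).arrow.HasRightResolutions := fun f => by
  obtain ⟨Z, s, hZ, hs⟩ := h f.left
  obtain ⟨V, g, t, ht, hg⟩ := exists_square_of_resolutions T N h s hs f.hom
  exact ⟨.mk (X₁ := Arrow.mk (T.homMk g : (⟨Z, hZ⟩ : T.FullSubcategory) ⟶ V))
    (Arrow.homMk s t hg.symm) ⟨hs, ht⟩⟩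

theorem isRightDerivabilityStructure_of_resolutions
    (h : ∀ X : H, ∃ (Z : H) (s : X ⟶ Z), T Z ∧ N.trW s) :
    (T.triangulatedLocalizerMorphism N).IsRightDerivabilityStructure := by
  have := isVerdierRightLocalizing_of_resolutions T N h
  let Φ := T.triangulatedLocalizerMorphism N
  have res : Φ.HasRightResolutions := fun X => by
    obtain ⟨Z, s, hZ, hs⟩ := h X
    exact ⟨.mk (X₁ := ⟨Z, hZ⟩) s hs⟩
  have : Φ.arrow.HasRightResolutions := hasRightResolutions_arrow T N h
  -- Any two resolutions map to a common third one.
  have (X : H) : IsConnected (Φ.RightResolution X) := by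
    have : Nonempty (Φ.RightResolution X) := res X
    refine zigzag_isConnected fun R R' => ?_
    obtain ⟨V, g, t, ht, hg⟩ := exists_square_of_resolutions T N h R.w R.hw R'.w
    have hw : N.trW (R'.w ≫ t) := N.trW.comp_mem _ _ R'.hw ht
    let R'' : Φ.RightResolution X := .mk (X₁ := V) (R'.w ≫ t) hw
    let a : R ⟶ R'' := { f := T.homMk g, comm := hg.symm }
    let b : R' ⟶ R'' := { f := T.homMk t, comm := rfl }
    exact (Zigzag.of_hom a).trans (Zigzag.of_inv b)
  let G := Φ.localizedFunctor (N.inverseImage T.ι).trW.Q N.trW.Q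
  -- Essential surjectivity comes from the resolutions, full faithfulness from `T` being Verdier
  -- right localizing.
  have : G.EssSurj := by
    have := Φ.essSurj_of_hasRightResolutions N.trW.Q
    have : ((N.inverseImage T.ι).trW.Q ⋙ G).EssSurj :=
      Functor.essSurj_of_iso (Φ.catCommSq (N.inverseImage T.ι).trW.Q N.trW.Q).iso
    exact ⟨fun Y => ⟨_, ⟨((N.inverseImage T.ι).trW.Q ⋙ G).objObjPreimageIso Y⟩⟩⟩
  have : Φ.IsLocalizedEquivalence := ⟨show G.IsEquivalence from { }⟩
  exact LocalizerMorphism.IsRightDerivabilityStructure.mk' Φ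

end Derivability

end AdaptedDerived

/-! ### Homotopy categories of complexes with prescribed terms. -/

namespace AdaptedDerived
open Pretriangulated ZeroObject

section Termwise

variable {C : Type*} [Category* C] [Abelian C]

/-- The objects that are isomorphic, up to homotopy, to a bounded below complex whose terms all
satisfy `P`. -/
def termwise (P : ObjectProperty C) : ObjectProperty (HomotopyCategory.Plus C) := fun K =>
  ∃ L : CochainComplex C ℤ, CochainComplex.plus C L ∧ (∀ i : ℤ, P (L.X i)) ∧
    Nonempty (K.obj ≅ (HomotopyCategory.quotient C (.up ℤ)).obj L)

variable (P : ObjectProperty C)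

instance : (termwise P).IsClosedUnderIsomorphisms where
  of_iso := by
    rintro K K' e ⟨L, hL, hP, ⟨e'⟩⟩
    exact ⟨L, hL, hP, ⟨(HomotopyCategory.Plus.ι C).mapIso e.symm ≪≫ e'⟩⟩

instance : (termwise P).IsStableUnderShift ℤ where
  isStableUnderShiftBy n :=
    { le_shift := by
        rintro K ⟨L, ⟨m, hm⟩, hP, ⟨e⟩⟩
        refine ⟨L⟦n⟧, ⟨m - n, L.isStrictlyGE_shift m n (m - n) (by lia)⟩, fun i => hP (i + n),
          ⟨((HomotopyCategory.Plus.ι C).commShiftIso n).app K ≪≫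
            (shiftFunctor (HomotopyCategory C (.up ℤ)) n).mapIso e ≪≫
              eqToIso (HomotopyCategory.shift_quotient_obj L n)⟩⟩ }

variable [P.IsClosedUnderIsomorphisms]

instance [P.ContainsZero] : (termwise P).ContainsZero where
  exists_zero := by
    have h : IsZero ((HomotopyCategory.quotient C (.up ℤ)).obj 0) :=
      Functor.map_isZero (HomotopyCategory.quotient C (.up ℤ)) (isZero_zero _)
    refine ⟨⟨(HomotopyCategory.quotient C (.up ℤ)).obj 0, ?_⟩, ?_,
      0, ⟨0, inferInstance⟩, fun i => ?_, ⟨Iso.refl _⟩⟩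
    · rw [HomotopyCategory.plus_quotient_obj_iff]
      exact ⟨0, inferInstance⟩
    · exact IsZero.of_full_of_faithful_of_isZero (HomotopyCategory.Plus.ι C) _ h
    · exact P.prop_of_isZero ((HomologicalComplex.eval C (.up ℤ) i).map_isZero (isZero_zero _))

theorem termwise_isTriangulated [P.ContainsZero]
    (hP : ∀ A B : C, P A → P B → P (A ⊞ B)) : (termwise P).IsTriangulated where
  toIsTriangulatedClosed₂ :=
    have : (termwise P).IsTriangulatedClosed₃ := .mk' (by
      rintro T hT ⟨L₁, ⟨n₁, hn₁⟩, hL₁, ⟨e₁⟩⟩ ⟨L₂, ⟨n₂, hn₂⟩, hL₂, ⟨e₂⟩⟩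
      obtain ⟨f, hf⟩ := (HomotopyCategory.quotient _ _).map_surjective
        (e₁.inv ≫ T.mor₁.hom ≫ e₂.hom)
      refine ⟨CochainComplex.mappingCone f,
        ⟨min (n₁ - 1) n₂, CochainComplex.isStrictlyGE_mappingCone f n₁ n₂ _ (by simp) (by simp)⟩,
        fun i => ?_, ⟨Triangle.π₃.mapIso
            (isoTriangleOfIso₁₂ ((HomotopyCategory.Plus.ι C).mapTriangle.obj T) _
              ((HomotopyCategory.Plus.ι C).map_distinguished T hT)
              (HomotopyCategory.mappingCone_triangleh_distinguished f) e₁ e₂ ?_)⟩⟩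
      -- The terms of a mapping cone are biproducts of terms of the two complexes.
      · exact P.prop_of_iso (HomologicalComplex.homotopyCofiber.XIsoBiprod f i (i + 1) rfl).symm
          (hP _ _ (hL₁ _) (hL₂ _))
      · have h : T.mor₁.hom ≫ e₂.hom =
            e₁.hom ≫ (HomotopyCategory.quotient C (.up ℤ)).map f := by
          rw [hf, e₁.hom_inv_id_assoc]
        exact h)
    .of_isTriangulatedClosed₃

theorem exists_termwise_resolution (I : ObjectProperty C) [I.ContainsZero]
    (hI : ∀ M : C, ∃ (J : C) (f : M ⟶ J), I J ∧ Mono f) (K : HomotopyCategory.Plus C) :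
    ∃ (L : HomotopyCategory.Plus C) (s : K ⟶ L), termwise I L ∧
      (HomotopyCategory.Plus.subcategoryAcyclic C).trW s := by
  obtain ⟨m, _⟩ : CochainComplex.plus C K.obj.as :=
    (HomotopyCategory.plus_quotient_obj_iff _).1 K.property
  obtain ⟨L, f, hL, hIL, hf⟩ := exists_quasiIso_of_enough hI K.obj.as m
  refine ⟨⟨(HomotopyCategory.quotient C (.up ℤ)).obj L, ?_⟩,
    ObjectProperty.homMk ((HomotopyCategory.quotient C (.up ℤ)).map f),
    ⟨L, ⟨m, hL⟩, hIL, ⟨Iso.refl _⟩⟩, ?_⟩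
  · rw [HomotopyCategory.plus_quotient_obj_iff]
    exact ⟨m, hL⟩
  · rw [← HomotopyCategory.Plus.quasiIso_eq_subcategoryAcyclic_trW]
    exact (HomotopyCategory.quotient_map_mem_quasiIso_iff f).2 hf

end Termwise

/-! ### Existence of the right derived functor. -/

section Derived

variable {C D : Type*} [Category* C] [Category* D] [Abelian C] [Abelian D]
  (F : C ⥤ D) [F.Additive] [PreservesFiniteLimits F] (I : ObjectProperty C)

variable {F I}

theorem acyclicClass_biprod (hF : IsAdaptedClass F I) (A B : C) (hA : acyclicClass F I A)
    (hB : acyclicClass F I B) : acyclicClass F I (A ⊞ B) :=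
  acyclicClass_ext hF (a := biprod.inl) (c := biprod.snd)
    (.of_desc biprod.inl_snd fun k hk => ⟨biprod.inr ≫ k, by
      apply biprod.hom_ext' <;> simp [hk]⟩) hA hB

theorem acyclicClass_containsZero (hF : IsAdaptedClass F I) :
    (acyclicClass F I).ContainsZero where
  exists_zero := ⟨0, isZero_zero C, acyclicClass_of_isZero hF (isZero_zero C)⟩

theorem termwise_acyclicClass_isTriangulated (hF : IsAdaptedClass F I) :
    (termwise (acyclicClass F I)).IsTriangulated :=
  have := acyclicClass_containsZero hF
  termwise_isTriangulated _ (acyclicClass_biprod hF)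

theorem exists_resolution (hF : IsAdaptedClass F I) (K : HomotopyCategory.Plus C) :
    ∃ (L : HomotopyCategory.Plus C) (s : K ⟶ L), termwise (acyclicClass F I) L ∧
      (HomotopyCategory.Plus.subcategoryAcyclic C).trW s := by
  have := hF.containsZero
  obtain ⟨L, s, hL, hs⟩ := exists_termwise_resolution I hF.exists_mono K
  obtain ⟨L', hL', h, he⟩ := hL
  exact ⟨L, s, ⟨L', hL', fun i => acyclicClass_of_mem hF (h i), he⟩, hs⟩

theorem subcategoryAcyclic_map (hF : IsAdaptedClass F I) (K : HomotopyCategory.Plus C)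
    (hK : termwise (acyclicClass F I) K)
    (hK' : HomotopyCategory.Plus.subcategoryAcyclic C K) :
    HomotopyCategory.Plus.subcategoryAcyclic D (F.mapHomotopyCategoryPlus.obj K) := by
  obtain ⟨L, ⟨m, _⟩, hL, ⟨e⟩⟩ := hK
  have hL' := (HomotopyCategory.quotient_obj_mem_subcategoryAcyclic_iff_acyclic L).1
    ((HomotopyCategory.subcategoryAcyclic C).prop_of_iso e hK')
  refine (HomotopyCategory.subcategoryAcyclic D).prop_of_iso
    ((F.mapHomotopyCategory (ComplexShape.up ℤ)).mapIso e).symm ?_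
  exact (HomotopyCategory.quotient_obj_mem_subcategoryAcyclic_iff_acyclic _).2
    (map_acyclic_of_acyclicClass (K := L) hF hL' hL m)

variable (F I) in
/-- The inclusion of the complexes with terms in the class `acyclicClass F I`, together with the
quasi-isomorphisms. -/
noncomputable abbrev acyclicLocalizer [(termwise (acyclicClass F I)).IsTriangulated] :=
  (termwise (acyclicClass F I)).triangulatedLocalizerMorphism
    (HomotopyCategory.Plus.subcategoryAcyclic C)

variable [(termwise (acyclicClass F I)).IsTriangulated]

theorem acyclicLocalizer_isRightDerivabilityStructure (hF : IsAdaptedClass F I) :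
    (acyclicLocalizer F I).IsRightDerivabilityStructure :=
  isRightDerivabilityStructure_of_resolutions _ _ (exists_resolution hF)

variable [HasDerivedCategory.{w₁} D]

/-- The cone of such a quasi-isomorphism is an acyclic complex with terms in the class, and `F`
keeps it acyclic. -/
theorem acyclicLocalizer_derives (hF : IsAdaptedClass F I) :
    (acyclicLocalizer F I).Derives (F.mapHomotopyCategoryPlus ⋙ DerivedCategory.Plus.Qh) := by
  intro K L f hf
  rw [ObjectProperty.trW_inverseImage_ι_iff, ObjectProperty.trW_iff] at hf
  obtain ⟨Z, a, b, hT, hZ⟩ := hf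
  apply Localization.inverts DerivedCategory.Plus.Qh
    (HomotopyCategory.Plus.subcategoryAcyclic D).trW
  rw [ObjectProperty.trW_iff]
  exact ⟨_, _, _, F.mapHomotopyCategoryPlus.map_distinguished _ hT,
    subcategoryAcyclic_map hF Z hZ.1 hZ.2⟩

omit [(termwise (acyclicClass F I)).IsTriangulated] in
theorem hasRightDerivedFunctor (hF : IsAdaptedClass F I) :
    (F.mapHomotopyCategoryPlus ⋙ DerivedCategory.Plus.Qh).HasRightDerivedFunctor
      (HomotopyCategory.Plus.quasiIso C) := by
  have := termwise_acyclicClass_isTriangulated hF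
  have := acyclicLocalizer_isRightDerivabilityStructure hF
  have := (acyclicLocalizer_derives hF).hasPointwiseRightDerivedFunctor
  rw [HomotopyCategory.Plus.quasiIso_eq_subcategoryAcyclic_trW]
  infer_instance

end Derived
end AdaptedDerived

/-! ### The derived functor on shifts and triangles. -/

namespace AdaptedDerived
open Pretriangulated

theorem isRightDerivedFunctor_of_eq {C D H : Type*} [Category* C] [Category* D] [Category* H]
    {L : C ⥤ D} {F : C ⥤ H} {RF : D ⥤ H} (α : F ⟶ L ⋙ RF) {W W' : MorphismProperty C}
    [L.IsLocalization W] [L.IsLocalization W'] (h : W = W') [RF.IsRightDerivedFunctor α W] :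
    RF.IsRightDerivedFunctor α W' := by
  subst h
  infer_instance

section RightDerived

open DerivedCategory

variable {C D : Type*} [Category* C] [Category* D] [Abelian C] [Abelian D]
  {F : C ⥤ D} [F.Additive] [PreservesFiniteLimits F] {I : ObjectProperty C}
  [HasDerivedCategory.{w₁} C]

theorem exists_acyclic_model (hF : IsAdaptedClass F I) (Z : Plus C) :
    ∃ K : HomotopyCategory.Plus C, termwise (acyclicClass F I) K ∧
      Nonempty (Plus.Qh.obj K ≅ Z) := by
  obtain ⟨K, s, hK, hs⟩ := exists_resolution hF (Plus.Qh.objPreimage Z)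
  have := Localization.inverts Plus.Qh _ _ hs
  exact ⟨K, hK, ⟨(asIso (Plus.Qh.map s)).symm ≪≫ Plus.Qh.objObjPreimageIso Z⟩⟩

variable [HasDerivedCategory.{w₂} D] {RF : Plus C ⥤ Plus D} (α : F.mapHomotopyCategoryPlus ⋙ Plus.Qh ⟶ Plus.Qh ⋙ RF)
  [RF.IsRightDerivedFunctor α (HomotopyCategory.Plus.quasiIso C)]

include α

/-- The right derived functor can be computed with complexes of acyclic objects. -/
theorem nonempty_iso_of_termwise (hF : IsAdaptedClass F I) {K : HomotopyCategory.Plus C}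
    (hK : termwise (acyclicClass F I) K) :
    Nonempty (RF.obj (Plus.Qh.obj K) ≅ Plus.Qh.obj (F.mapHomotopyCategoryPlus.obj K)) := by
  have := termwise_acyclicClass_isTriangulated hF
  have := acyclicLocalizer_isRightDerivabilityStructure hF
  have : RF.IsRightDerivedFunctor α (HomotopyCategory.Plus.subcategoryAcyclic C).trW :=
    isRightDerivedFunctor_of_eq α (HomotopyCategory.Plus.quasiIso_eq_subcategoryAcyclic_trW C)
  have h : IsIso (α.app K) :=
    (acyclicLocalizer_derives hF).isIso_of_isRightDerivedFunctor α ⟨K, hK⟩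
  exact ⟨(asIso (α.app K)).symm⟩

/-- On an acyclic model `RF` is `F` applied termwise, which commutes with shifts. An isomorphism for
each object is all that is needed, so naturality is not pursued. -/
theorem nonempty_shift_iso (hF : IsAdaptedClass F I) (Z : Plus C) (n : ℤ) :
    Nonempty (RF.obj (Z⟦n⟧) ≅ (RF.obj Z)⟦n⟧) := by
  obtain ⟨K, hK, ⟨e⟩⟩ := exists_acyclic_model hF Z
  have hK' : termwise (acyclicClass F I) (K⟦n⟧) := (termwise (acyclicClass F I)).le_shift n _ hK
  obtain ⟨e₁⟩ := nonempty_iso_of_termwise α hF hK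
  obtain ⟨e₂⟩ := nonempty_iso_of_termwise α hF hK'
  exact ⟨RF.mapIso ((shiftFunctor _ n).mapIso e.symm ≪≫ (Plus.Qh.commShiftIso n).symm.app K) ≪≫
    e₂ ≪≫ ((F.mapHomotopyCategoryPlus ⋙ Plus.Qh).commShiftIso n).app K ≪≫
    (shiftFunctor _ n).mapIso (e₁.symm ≪≫ RF.mapIso e)⟩

/-- The first morphism is modelled by a map of complexes of acyclic objects, whose cone is of the
same kind. `F` maps that triangle to a distinguished one, and on its three vertices `F` computes
`RF`. -/
theorem exists_distinguished (hF : IsAdaptedClass F I) (T : Triangle (Plus C))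
    (hT : T ∈ distTriang (Plus C)) :
    ∃ T' ∈ distTriang (Plus D), Nonempty (RF.obj T.obj₁ ≅ T'.obj₁) ∧
      Nonempty (RF.obj T.obj₂ ≅ T'.obj₂) ∧ Nonempty (RF.obj T.obj₃ ≅ T'.obj₃) := by
  have := termwise_acyclicClass_isTriangulated hF
  let φ := Plus.Qh.mapArrow.objPreimage (Arrow.mk T.mor₁)
  let e := Plus.Qh.mapArrow.objObjPreimageIso (Arrow.mk T.mor₁)
  obtain ⟨ρ⟩ := hasRightResolutions_arrow (termwise (acyclicClass F I)) _ (exists_resolution hF) φ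
  obtain ⟨K, hK, b, c, hτ⟩ := (termwise (acyclicClass F I)).distinguished_cocone_triangle
    ρ.X₁.hom.hom ρ.X₁.left.property ρ.X₁.right.property
  have h₁ := Localization.inverts Plus.Qh _ _ ρ.hw.1
  have h₂ := Localization.inverts Plus.Qh _ _ ρ.hw.2
  let e' : Plus.Qh.mapArrow.obj φ ≅ Arrow.mk (Plus.Qh.map ρ.X₁.hom.hom) :=
    Arrow.isoMk (@asIso _ _ _ _ (Plus.Qh.map ρ.w.left) h₁) (@asIso _ _ _ _ (Plus.Qh.map ρ.w.right) h₂)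
      ((Plus.Qh.map_comp _ _).symm.trans ((congrArg Plus.Qh.map ρ.w.w).trans
        (Plus.Qh.map_comp _ _)))
  obtain ⟨ε, -⟩ := exists_iso_of_arrow_iso _ _ hT (Plus.Qh.map_distinguished _ hτ) (e.symm ≪≫ e')
  obtain ⟨i₁⟩ := nonempty_iso_of_termwise α hF ρ.X₁.left.property
  obtain ⟨i₂⟩ := nonempty_iso_of_termwise α hF ρ.X₁.right.property
  obtain ⟨i₃⟩ := nonempty_iso_of_termwise α hF hK
  exact ⟨_, Plus.Qh.map_distinguished _ (F.mapHomotopyCategoryPlus.map_distinguished _ hτ),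
    ⟨RF.mapIso (Triangle.π₁.mapIso ε) ≪≫ i₁⟩, ⟨RF.mapIso (Triangle.π₂.mapIso ε) ≪≫ i₂⟩,
    ⟨RF.mapIso (Triangle.π₃.mapIso ε) ≪≫ i₃⟩⟩

end RightDerived
end AdaptedDerived

/-! ### The essential image of `D^b(coh)` and the restriction of the derived functor. -/

namespace AdaptedDerived
open Pretriangulated

section Inclusion

open DerivedCategory DerivedCategory.TStructure

variable (X : Scheme.{u}) [IsNoetherian X] [HasDerivedCategory.{w₁} (Coh X)]
  [HasDerivedCategory.{w₂} (Qcoh X)]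

theorem homBijective_cohToQcoh (K L : DerivedCategory (Coh X)) (hK : t.bounded K)
    (hL : t.bounded L) : HomBijective (cohToQcoh X).mapDerivedCategory K L :=
  homBijective_of_bounded (cohToQcoh X) (fun b a p _ => exists_coh_epi b a p) K L hK hL

instance : (dbCohInclusion X).Full where
  map_surjective {K L} f := by
    obtain ⟨g, hg⟩ := (homBijective_cohToQcoh X K.obj L.obj K.property L.property).2 f.hom
    exact ⟨ObjectProperty.homMk g, ObjectProperty.hom_ext _ hg⟩

instance : (dbCohInclusion X).Faithful where
  map_injective {K L} _ _ h := ObjectProperty.hom_ext _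
    ((homBijective_cohToQcoh X K.obj L.obj K.property L.property).1
      (congrArg (fun φ => φ.hom) h))

variable {X}

theorem mem_essImage_iff (Z : Plus (Qcoh X)) : (dbCohInclusion X).essImage Z ↔
    ∃ K : DerivedCategory (Coh X), t.bounded K ∧
      Nonempty ((cohToQcoh X).mapDerivedCategory.obj K ≅ Z.obj) :=
  ⟨fun ⟨K, ⟨e⟩⟩ => ⟨K.obj, K.property, ⟨Plus.ι.mapIso e⟩⟩,
    fun ⟨K, hK, ⟨e⟩⟩ => ⟨⟨K, hK⟩, ⟨Plus.ι.preimageIso e⟩⟩⟩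

theorem essImage_shift {Z : Plus (Qcoh X)} (hZ : (dbCohInclusion X).essImage Z) (n : ℤ) :
    (dbCohInclusion X).essImage (Z⟦n⟧) := by
  rw [mem_essImage_iff] at hZ ⊢
  obtain ⟨K, hK, ⟨e⟩⟩ := hZ
  exact ⟨K⟦n⟧, t.bounded.le_shift n _ hK,
    ⟨((cohToQcoh X).mapDerivedCategory.commShiftIso n).app K ≪≫
      (shiftFunctor _ n).mapIso e ≪≫ ((Plus.ι (C := Qcoh X)).commShiftIso n).symm.app Z⟩⟩

/-- Fullness lifts `T.mor₁` to bounded complexes of coherent sheaves, and the cone of the lift maps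
to an object isomorphic to `T.obj₃`. -/
theorem essImage_cone (T : Triangle (Plus (Qcoh X))) (hT : T ∈ distTriang (Plus (Qcoh X)))
    (h₁ : (dbCohInclusion X).essImage T.obj₁) (h₂ : (dbCohInclusion X).essImage T.obj₂) :
    (dbCohInclusion X).essImage T.obj₃ := by
  rw [mem_essImage_iff] at h₁ h₂ ⊢
  obtain ⟨K₁, hK₁, ⟨e₁⟩⟩ := h₁
  obtain ⟨K₂, hK₂, ⟨e₂⟩⟩ := h₂
  obtain ⟨f, hf⟩ := (homBijective_cohToQcoh X K₁ K₂ hK₁ hK₂).2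
    (e₁.hom ≫ T.mor₁.hom ≫ e₂.inv)
  obtain ⟨K₃, hK₃, g, h, hK⟩ := t.bounded.distinguished_cocone_triangle f hK₁ hK₂
  have comm : (cohToQcoh X).mapDerivedCategory.map f ≫ e₂.hom = e₁.hom ≫ T.mor₁.hom := by
    rw [hf, Category.assoc, Category.assoc, e₂.inv_hom_id, Category.comp_id]
  exact ⟨K₃, hK₃, ⟨Triangle.π₃.mapIso (isoTriangleOfIso₁₂ _ _
    ((cohToQcoh X).mapDerivedCategory.map_distinguished _ hK)
    ((Plus.ι (C := Qcoh X)).map_distinguished T hT) e₁ e₂ comm)⟩⟩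

end Inclusion

section Restriction

open DerivedCategory DerivedCategory.TStructure

variable {X Y : Scheme.{u}} [IsNoetherian X] [IsNoetherian Y]
  [HasDerivedCategory.{w₁} (Qcoh X)] [HasDerivedCategory.{w₁} (Qcoh Y)]
  [HasDerivedCategory.{w₂} (Coh X)] [HasDerivedCategory.{w₂} (Coh Y)]
  {F : Qcoh X ⥤ Qcoh Y} [F.Additive] [PreservesFiniteLimits F] {I : ObjectProperty (Qcoh X)}
  {RF : Plus (Qcoh X) ⥤ Plus (Qcoh Y)}
  (α : F.mapHomotopyCategoryPlus ⋙ Plus.Qh ⟶ Plus.Qh ⋙ RF)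
  [RF.IsRightDerivedFunctor α (HomotopyCategory.Plus.quasiIso (Qcoh X))]

include α

theorem essImage_rightDerived (hF : IsAdaptedClass F I)
    (h : ∀ M : Coh X, (dbCohInclusion Y).essImage
      (RF.obj ((Plus.singleFunctor (Qcoh X) 0).obj ((cohToQcoh X).obj M)))) (K : Bounded (Coh X)) :
    (dbCohInclusion Y).essImage (RF.obj ((dbCohInclusion X).obj K)) := by
  let Φ := (cohToQcoh X).mapDerivedCategory
  -- Dévissage runs over all of `D(coh X)`, where `Φ.obj K` need not be bounded below; hence the
  -- auxiliary object `Z` of `D^+`.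
  let S : ObjectProperty (DerivedCategory (Coh X)) := fun K =>
    ∃ Z : Plus (Qcoh X), (dbCohInclusion Y).essImage (RF.obj Z) ∧ Nonempty (Z.obj ≅ Φ.obj K)
  have : S.IsClosedUnderIsomorphisms :=
    ⟨fun e ⟨Z, hZ, ⟨i⟩⟩ => ⟨Z, hZ, ⟨i ≪≫ Φ.mapIso e⟩⟩⟩
  have hS : S K.obj := by
    refine prop_of_bounded_of_cone S ?_ ?_ ?_ K.obj K.property
    · rintro K ⟨Z, hZ, ⟨i⟩⟩ n
      obtain ⟨e⟩ := nonempty_shift_iso α hF Z n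
      exact ⟨Z⟦n⟧, (dbCohInclusion Y).essImage.prop_of_iso e.symm (essImage_shift hZ n),
        ⟨((Plus.ι (C := Qcoh X)).commShiftIso n).app Z ≪≫ (shiftFunctor _ n).mapIso i ≪≫
          (Φ.commShiftIso n).symm.app K⟩⟩
    · rintro T hT ⟨Z₁, hZ₁, ⟨i₁⟩⟩ - ⟨Z₂, hZ₂, ⟨i₂⟩⟩ -
      let f : Z₁ ⟶ Z₂ := ObjectProperty.homMk (i₁.hom ≫ Φ.map T.mor₁ ≫ i₂.inv)
      obtain ⟨Z₃, g, h, hZ⟩ := distinguished_cocone_triangle f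
      obtain ⟨T', hT', ⟨e₁⟩, ⟨e₂⟩, ⟨e₃⟩⟩ := exists_distinguished α hF _ hZ
      have comm : (i₁.hom ≫ Φ.map T.mor₁ ≫ i₂.inv) ≫ i₂.hom = i₁.hom ≫ Φ.map T.mor₁ := by
        rw [Category.assoc, Category.assoc, i₂.inv_hom_id, Category.comp_id]
      refine ⟨Z₃, (dbCohInclusion Y).essImage.prop_of_iso e₃.symm (essImage_cone T' hT'
        ((dbCohInclusion Y).essImage.prop_of_iso e₁ hZ₁)
        ((dbCohInclusion Y).essImage.prop_of_iso e₂ hZ₂)), ⟨Triangle.π₃.mapIso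
          (isoTriangleOfIso₁₂ _ _ ((Plus.ι (C := Qcoh X)).map_distinguished _ hZ)
            (Φ.map_distinguished T hT) i₁ i₂ comm)⟩⟩
    · exact fun M => ⟨_, h M, ⟨((cohToQcoh X).mapDerivedCategorySingleFunctor 0).symm.app M⟩⟩
  obtain ⟨Z, hZ, ⟨i⟩⟩ := hS
  exact (dbCohInclusion Y).essImage.prop_of_iso
    (RF.mapIso (Plus.ι.preimageIso i : Z ≅ (dbCohInclusion X).obj K)) hZ

end Restriction

theorem exists_lift_of_essImage {A B C : Type*} [Category* A] [Category* B] [Category* C]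
    (j : B ⥤ C) [j.Full] [j.Faithful] (H : A ⥤ C) (h : ∀ a, j.essImage (H.obj a)) :
    ∃ G : A ⥤ B, Nonempty (G ⋙ j ≅ H) :=
  ⟨j.essImage.lift H h ⋙ j.toEssImage.inv,
    ⟨Functor.isoWhiskerLeft (j.essImage.lift H h ⋙ j.toEssImage.inv) j.toEssImageCompι.symm ≪≫
      Functor.isoWhiskerRight (Functor.isoWhiskerLeft (j.essImage.lift H h)
        j.toEssImage.asEquivalence.counitIso) j.essImage.ι⟩⟩

end AdaptedDerived

theorem mainTheorem6 {X Y : Scheme.{u}} [IsNoetherian X] [IsNoetherian Y]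
    [HasDerivedCategory.{w₁} (AdaptedDerived.Qcoh X)]
    [HasDerivedCategory.{w₁} (AdaptedDerived.Qcoh Y)]
    [HasDerivedCategory.{w₂} (AdaptedDerived.Coh X)]
    [HasDerivedCategory.{w₂} (AdaptedDerived.Coh Y)]
    (F : AdaptedDerived.Qcoh X ⥤ AdaptedDerived.Qcoh Y) [F.Additive] [PreservesFiniteLimits F]
    (hF : ∃ I : ObjectProperty (AdaptedDerived.Qcoh X), AdaptedDerived.IsAdaptedClass F I) :
    (F.mapHomotopyCategoryPlus ⋙ DerivedCategory.Plus.Qh).HasRightDerivedFunctor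
        (HomotopyCategory.Plus.quasiIso (AdaptedDerived.Qcoh X)) ∧
      ∀ (RF : DerivedCategory.Plus (AdaptedDerived.Qcoh X) ⥤
            DerivedCategory.Plus (AdaptedDerived.Qcoh Y))
          (α : F.mapHomotopyCategoryPlus ⋙ DerivedCategory.Plus.Qh ⟶
            DerivedCategory.Plus.Qh ⋙ RF)
          [RF.IsRightDerivedFunctor α
            (HomotopyCategory.Plus.quasiIso (AdaptedDerived.Qcoh X))],
        (∀ M : AdaptedDerived.Coh X,
          (AdaptedDerived.dbCohInclusion Y).essImage
            (RF.obj ((DerivedCategory.Plus.singleFunctor (AdaptedDerived.Qcoh X) 0).obj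
              ((AdaptedDerived.cohToQcoh X).obj M)))) →
        ∃ G : DerivedCategory.Bounded (AdaptedDerived.Coh X) ⥤
            DerivedCategory.Bounded (AdaptedDerived.Coh Y),
          Nonempty (G ⋙ AdaptedDerived.dbCohInclusion Y ≅
            AdaptedDerived.dbCohInclusion X ⋙ RF) := by
  obtain ⟨I, hI⟩ := hF
  refine ⟨AdaptedDerived.hasRightDerivedFunctor hI, fun RF α _ h => ?_⟩
  exact AdaptedDerived.exists_lift_of_essImage (AdaptedDerived.dbCohInclusion Y)
    (AdaptedDerived.dbCohInclusion X ⋙ RF) (AdaptedDerived.essImage_rightDerived α hI h)
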